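/- Let $k$ be a field and let $A=\bigoplus_{i\in\mathbb Z}A_i$ be a connected graded $k$-algebra ($A_0=k$, $A_i=0$ for $i<0$). Modules are graded right modules, $M(n)_i=M_{n+i}$, and $k_A=A/A_{\ge 1}$. Let $f\in A_m$, $m\ge 1$, be regular ($af=0$ or $fa=0$ implies $a=0$) and normal ($Af=fA$), put $B=A/(f)$ and $k_B=B/B_{\ge1}$, let $\sigma$ be the automorphism of $A$ with $fa=\sigma(a)f$ for all $a\in A$, and put $\tau=\sigma^{-1}$. Morphisms between graded free modules with chosen homogeneous bases are regarded as (column-finite) matrices over $A$, and $\tau^n\cdot\varphi$ denotes the matrix obtained by applying $\tau^n$ to all entries of $\varphi$. Let $P_\bullet=(P_i,d_i)\xrightarrow{\varepsilon}k_A$ be a minimal graded free resolution, i.e. $d_{i+1}(P_{i+1})\subseteq P_iA_{\ge1}$ for all $i\ge 0$, and put $P_i=0$ for $i<0$. A system of higher homotopies is a family of degree-preserving right $A$-linear maps $c^n_l:P_l(-nm)\to P_{l+2n-1}$ ($n,l\ge 0$; $c^n_l=0$ for $l<0$) with $c^0_l=d_l$ and, for all $l\ge0$, $$ f\cdot I=c^1_{l-1}(\tau\cdot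 d_l)+d_{l+1}c^1_l,\qquad -\sum_{0<i<n}c^i_{l+2(n-i)-1}\,(\tau^i\cdot c^{n-i}_l)=c^n_{l-1}(\tau^n\cdot d_l)+d_{l+2n-1}c^n_l\quad(n\ge 2),$$ where $f\cdot I$ is the scalar matrix with diagonal entries $f$. Then a system of higher homotopies exists. Moreover, for every such system let $$T_i=\bigoplus_{0\le s\le\lfloor i/2\rfloor}P_{i-2s}(-sm)\otimes_AB ,$$ and let $\partial_i:T_i\to T_{i-1}$ be the upper triangular block matrix whose block from the summand $s$ of $T_i$ to the summand $t$ of $T_{i-1}$ is $(\tau^t\cdot c^{s-t}_{i-2s})\otimes_AB$ for $t\le s$ and $0$ for $t>s$. Then: 1. $T_\bullet=(T_i,\partial_i)$, with augmentation $\varepsilon\otimes_AB:T_0\to k_A\otimes_AB=k_B$, is a graded free resolution of $k_B$ over $B$. 2. If in addition $A$ is Koszul (i.e. $k_A$ has a resolution by graded projective modules $Q_i$ with $Q_i$ generated by its component of degree $i$) and $m\ge2$, then $T_\bullet$ is a minimal resolution: $\partial_{i+1}(T_{i+1})\subseteq T_iB_{\ge1}$ for all $i\ge 0$. 3. If in addition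 $A$ is Koszul and $m=2$, then $T_\bullet$ is a linear resolution: each $T_i$ is generated in degree $i$. -/

import Mathlib

open MulOpposite

namespace NormalQuotient

universe u v w

section Ring

variable {A : Type v} [Ring A]

/-- `f` is regular: `a f = 0` or `f a = 0` implies `a = 0`. -/
def IsRegularElt (f : A) : Prop :=
  ∀ a : A, a * f = 0 ∨ f * a = 0 → a = 0

/-- `f` is normal: `A f = f A`. -/
def IsNormalElt (f : A) : Prop :=
  (Set.range fun a : A => a * f) = Set.range fun a : A => f * a

theorem IsNormalElt.exists_left {f : A} (hn : IsNormalElt f) (a : A) :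
    ∃ b : A, b * f = f * a := by
  have h : f * a ∈ Set.range fun a : A => f * a := ⟨a, rfl⟩
  rw [← hn] at h
  exact h

theorem IsNormalElt.exists_right {f : A} (hn : IsNormalElt f) (a : A) :
    ∃ b : A, f * b = a * f := by
  have h : a * f ∈ Set.range fun a : A => a * f := ⟨a, rfl⟩
  rw [hn] at h
  exact h

theorem IsRegularElt.right_cancel {f : A} (hr : IsRegularElt f) {a b : A}
    (h : a * f = b * f) : a = b :=
  sub_eq_zero.mp (hr _ (Or.inl (by rw [sub_mul, h, sub_self])))

theorem IsRegularElt.left_cancel {f : A} (hr : IsRegularElt f) {a b : A}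
    (h : f * a = f * b) : a = b :=
  sub_eq_zero.mp (hr _ (Or.inr (by rw [mul_sub, h, sub_self])))

/-- The normalizing automorphism `σ` of a regular normal element `f`, characterised by
`f a = σ(a) f` (see `normalizingAut_spec`). -/
noncomputable def normalizingAut {f : A} (hr : IsRegularElt f) (hn : IsNormalElt f) :
    RingAut A where
  toFun a := (hn.exists_left a).choose
  invFun a := (hn.exists_right a).choose
  left_inv a := hr.left_cancel (by
    rw [(hn.exists_right _).choose_spec, (hn.exists_left a).choose_spec])
  right_inv a := hr.right_cancel (by
    rw [(hn.exists_left _).choose_spec, (hn.exists_right a).choose_spec])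
  map_mul' a b := hr.right_cancel (by
    rw [(hn.exists_left _).choose_spec, mul_assoc _ _ f, (hn.exists_left b).choose_spec,
      ← mul_assoc, ← mul_assoc, (hn.exists_left a).choose_spec])
  map_add' a b := hr.right_cancel (by
    rw [(hn.exists_left _).choose_spec, add_mul, (hn.exists_left a).choose_spec,
      (hn.exists_left b).choose_spec, mul_add])

theorem normalizingAut_spec {f : A} (hr : IsRegularElt f) (hn : IsNormalElt f) (a : A) :
    f * a = normalizingAut hr hn a * f :=
  (hn.exists_left a).choose_spec.symm

/-! Right `A`-modules are modules over `Aᵐᵒᵖ`.  The free right `A`-module on a basis `ι` is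
`ι →₀ A`; its elements are column vectors, and a morphism of free modules is the (column finite)
matrix whose column at `b` is the image of the basis vector `e_b = Finsupp.single b 1`. -/

/-- The right linear map out of a free right module with prescribed images of the basis
vectors. -/
noncomputable def ofColumns {ι : Type*} {M : Type*} [AddCommGroup M] [Module Aᵐᵒᵖ M]
    (v : ι → M) : (ι →₀ A) →ₗ[Aᵐᵒᵖ] M where
  toFun x := x.sum fun b a => op a • v b
  map_add' x y := by
    classical
    exact Finsupp.sum_add_index (by simp) (by intro b _ a a'; rw [op_add, add_smul])
  map_smul' r x := by
    rw [Finsupp.sum_smul_index' (by simp), Finsupp.smul_sum]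
    refine Finsupp.sum_congr fun b _ => ?_
    rw [RingHom.id_apply, ← mul_smul]
    rfl

/-- Apply a ring homomorphism `g : A → B` to all entries of a matrix over `A`.
For an automorphism `g` of `A` this is the twist `g · φ`; for a quotient map `g : A → B` it is
the base change `φ ⊗_A B` (under the identification of `F ⊗_A B` with the free right `B`-module
on the same basis). -/
noncomputable def mapEntries {B : Type*} [Ring B] (g : A →+* B) {ι κ : Type*}
    (φ : (ι →₀ A) →ₗ[Aᵐᵒᵖ] (κ →₀ A)) : (ι →₀ B) →ₗ[Bᵐᵒᵖ] (κ →₀ B) :=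
  ofColumns fun b => (φ (Finsupp.single b 1)).mapRange g g.map_zero

/-- The scalar matrix `f I`: left multiplication of every coordinate by `f`. -/
noncomputable def leftMul (ι : Type*) (f : A) : (ι →₀ A) →ₗ[Aᵐᵒᵖ] (ι →₀ A) :=
  ofColumns fun b => Finsupp.single b f

/-- The block matrix with blocks `M s t` (from the `s`-th summand of the source to the `t`-th
summand of the target). -/
noncomputable def blockMatrix {S T : Type*} [Fintype T] {ι : S → Type*} {κ : T → Type*}
    (M : ∀ s t, (ι s →₀ A) →ₗ[Aᵐᵒᵖ] (κ t →₀ A)) :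
    ((Σ s, ι s) →₀ A) →ₗ[Aᵐᵒᵖ] ((Σ t, κ t) →₀ A) :=
  ofColumns fun x => ∑ t, (M x.1 t (Finsupp.single x.2 1)).mapDomain (Sigma.mk t)

end Ring

section Graded

variable {k : Type u} [Field k] {A : Type v} [Ring A] [Algebra k A]

/-- A graded algebra is connected if `A_0 = k` and `A_i = 0` for `i < 0`. -/
structure IsConnectedGraded (𝒜 : ℤ → Submodule k A) : Prop where
  injective : Function.Injective (algebraMap k A)
  zero : 𝒜 0 = LinearMap.range (Algebra.linearMap k A)
  neg : ∀ i : ℤ, i < 0 → 𝒜 i = ⊥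

/-- The right ideal `A_{≥ 1}`. -/
def augIdeal (𝒜 : ℤ → Submodule k A) : Submodule Aᵐᵒᵖ A :=
  Submodule.span Aᵐᵒᵖ {a | ∃ i : ℤ, 1 ≤ i ∧ a ∈ 𝒜 i}

/-- The right module `k_A = A / A_{≥ 1}`. -/
abbrev TrivialModule (𝒜 : ℤ → Submodule k A) : Type v := A ⧸ augIdeal 𝒜

/-- The degree `i` part of `k_A`. -/
def trivialGrading (𝒜 : ℤ → Submodule k A) (i : ℤ) : Set (TrivialModule 𝒜) :=
  {x | ∃ a ∈ 𝒜 i, (augIdeal 𝒜).mkQ a = x}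

/-- The data of a sequence `⋯ → P_1 → P_0 → k_A` of graded free right modules
`P_i = ⨁_{b : ι i} A(-deg b)`. As for Mathlib's homological complexes, `d i j : P_i → P_j` is
given for all `i`, `j` and only `d (j + 1) j` is relevant. -/
structure AugmentedSequence (𝒜 : ℤ → Submodule k A) where
  ι : ℕ → Type w
  deg : ∀ i, ι i → ℤ
  d : ∀ i j, (ι i →₀ A) →ₗ[Aᵐᵒᵖ] (ι j →₀ A)
  ε : (ι 0 →₀ A) →ₗ[Aᵐᵒᵖ] TrivialModule 𝒜

namespace AugmentedSequence

variable {𝒜 : ℤ → Submodule k A}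

/-- The sequence is a graded free resolution of `k_A`: all maps preserve degrees and the
augmented sequence `⋯ → P_1 → P_0 → k_A → 0` is exact. -/
structure IsFreeResolution (P : AugmentedSequence.{u, v, w} 𝒜) : Prop where
  shape : ∀ i j, j + 1 ≠ i → P.d i j = 0
  d_degree : ∀ i j b a,
    P.d i j (Finsupp.single b 1) a ∈ 𝒜 (P.deg i b - P.deg j a)
  ε_degree : ∀ b, P.ε (Finsupp.single b 1) ∈ trivialGrading 𝒜 (P.deg 0 b)
  exact : ∀ i, Function.Exact (P.d (i + 2) (i + 1)) (P.d (i + 1) i)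
  exact_zero : Function.Exact (P.d 1 0) P.ε
  surjective : Function.Surjective P.ε

/-- Minimality: `d(P_{i + 1}) ⊆ P_i A_{≥ 1}`. -/
def IsMinimal (P : AugmentedSequence.{u, v, w} 𝒜) : Prop :=
  ∀ i x a, P.d (i + 1) i x a ∈ augIdeal 𝒜

/-- Linearity: the free module `P_i` is generated in degree `i`. -/
def IsLinear (P : AugmentedSequence.{u, v, w} 𝒜) : Prop :=
  ∀ i b, P.deg i b = i

end AugmentedSequence

/-- A linear resolution of `k_A` by graded projective right modules `Q_i = (Q_i)_i A`. -/
structure LinearResolution (𝒜 : ℤ → Submodule k A) where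
  Q : ℕ → Type v
  [addCommGroup : ∀ i, AddCommGroup (Q i)]
  [module : ∀ i, Module Aᵐᵒᵖ (Q i)]
  grading : ∀ i, ℤ → AddSubgroup (Q i)
  isInternal : ∀ i, DirectSum.IsInternal (grading i)
  smul_mem : ∀ i (p q : ℤ), ∀ x ∈ grading i p, ∀ a ∈ 𝒜 q, op a • x ∈ grading i (p + q)
  projective : ∀ i, Module.Projective Aᵐᵒᵖ (Q i)
  generated : ∀ i : ℕ, Submodule.span Aᵐᵒᵖ (grading i i : Set (Q i)) = ⊤
  d : ∀ i, Q (i + 1) →ₗ[Aᵐᵒᵖ] Q i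
  d_degree : ∀ i p, ∀ x ∈ grading (i + 1) p, d i x ∈ grading i p
  ε : Q 0 →ₗ[Aᵐᵒᵖ] TrivialModule 𝒜
  ε_degree : ∀ p, ∀ x ∈ grading 0 p, ε x ∈ trivialGrading 𝒜 p
  exact : ∀ i, Function.Exact (d (i + 1)) (d i)
  exact_zero : Function.Exact (d 0) ε
  surjective : Function.Surjective ε

/-- `A` is Koszul if `k_A` admits a linear resolution. -/
def IsKoszul (𝒜 : ℤ → Submodule k A) : Prop := Nonempty (LinearResolution 𝒜)

/-- The quotient algebra `B = A / (f)` by the two-sided ideal generated by `f`. -/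
abbrev QuotAlg (f : A) : Type v := (TwoSidedIdeal.span {f}).ringCon.Quotient

/-- The projection `A → A / (f)`. -/
def quotMap (f : A) : A →+* QuotAlg f := (TwoSidedIdeal.span {f}).ringCon.mk'

/-- The grading of `A / (f)` induced by that of `A`. -/
def quotGrading (𝒜 : ℤ → Submodule k A) (f : A) (i : ℤ) : Submodule k (QuotAlg f) :=
  (𝒜 i).map
    ({ quotMap f with map_smul' := fun _ _ => rfl } : A →ₗ[k] QuotAlg f)

/-- The map `k_A → k_B` induced by `A → B = A / (f)`. -/
def residueMap (𝒜 : ℤ → Submodule k A) (f : A) :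
    TrivialModule 𝒜 →+ TrivialModule (quotGrading 𝒜 f) :=
  QuotientAddGroup.map (augIdeal 𝒜).toAddSubgroup (augIdeal (quotGrading 𝒜 f)).toAddSubgroup
    (quotMap f).toAddMonoidHom (by
      intro x hx
      induction hx using Submodule.span_induction with
      | mem x hx =>
        obtain ⟨i, hi, hx⟩ := hx
        exact Submodule.subset_span ⟨i, hi, x, hx, rfl⟩
      | zero => exact AddSubgroup.zero_mem _
      | add x y _ _ hx hy => exact AddSubgroup.add_mem _ hx hy
      | smul r x _ hx =>
        have h := (augIdeal (quotGrading 𝒜 f)).smul_mem (op (quotMap f r.unop)) hx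
        have e : op (quotMap f r.unop) • quotMap f x = quotMap f (r • x) :=
          ((quotMap f).map_mul x r.unop).symm
        exact e.subst (motive := fun y => y ∈ augIdeal (quotGrading 𝒜 f)) h)

section Construction

variable {𝒜 : ℤ → Submodule k A} {f : A}

/-- The twist `τⁿ · φ` of a matrix, where `τ = σ⁻¹` is the inverse of the normalizing
automorphism of `f`. -/
noncomputable def twist (hr : IsRegularElt f) (hn : IsNormalElt f) (n : ℕ) {ι κ : Type*}
    (φ : (ι →₀ A) →ₗ[Aᵐᵒᵖ] (κ →₀ A)) : (ι →₀ A) →ₗ[Aᵐᵒᵖ] (κ →₀ A) :=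
  mapEntries (((normalizingAut hr hn)⁻¹ ^ n : RingAut A) : A →+* A) φ

/-- `c` is a system of higher homotopies `c^n_l : τⁿ P_•(-nm)_l → P_{l + 2n - 1}` for `f` on
`P_•`, where `c^0 = d`. The map `c^n_l` is `c n l (l + 2 * n - 1)`; the maps `c n l l'` with
`l' + 1 ≠ l + 2 n` are zero. In `one` and `higher`, for `l = 0` the first term on the right-hand
side vanishes, since `d 0 0 = 0`. -/
structure IsHomotopySystem (P : AugmentedSequence.{u, v, w} 𝒜)
    (hr : IsRegularElt f) (hn : IsNormalElt f) (m : ℤ)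
    (c : ℕ → ∀ l l', (P.ι l →₀ A) →ₗ[Aᵐᵒᵖ] (P.ι l' →₀ A)) : Prop where
  zero : c 0 = P.d
  shape : ∀ n l l', l' + 1 ≠ l + 2 * n → c n l l' = 0
  degree : ∀ (n l l' : ℕ) b a,
    c n l l' (Finsupp.single b 1) a ∈ 𝒜 (P.deg l b + (n : ℤ) * m - P.deg l' a)
  one : ∀ l, leftMul (P.ι l) f =
    c 1 (l - 1) l ∘ₗ twist hr hn 1 (P.d l (l - 1)) + P.d (l + 1) l ∘ₗ c 1 l (l + 1)
  higher : ∀ n, 2 ≤ n → ∀ l,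
    -∑ i ∈ Finset.Ioo 0 n,
        c i (l + 2 * (n - i) - 1) (l + 2 * n - 2) ∘ₗ
          twist hr hn i (c (n - i) l (l + 2 * (n - i) - 1)) =
      c n (l - 1) (l + 2 * n - 2) ∘ₗ twist hr hn n (P.d l (l - 1)) +
        P.d (l + 2 * n - 1) (l + 2 * n - 2) ∘ₗ c n l (l + 2 * n - 1)

/-- The sequence `T_•` of free right `B`-modules, `B = A / (f)`:
`T_i = ⨁_{0 ≤ s ≤ ⌊i/2⌋} P_{i - 2s}(-sm) ⊗_A B`, whose differential `T_i → T_j` (`j = i - 1`) is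
the upper triangular block matrix with block `(τ^t · c^{s - t}_{i - 2s}) ⊗ B` in row `t` and
column `s` for `t ≤ s`; the augmentation is `ε ⊗_A B : T_0 = P_0 ⊗_A B → k_A ⊗_A B = k_B`. -/
noncomputable def quotientSequence (P : AugmentedSequence.{u, v, w} 𝒜)
    (hr : IsRegularElt f) (hn : IsNormalElt f) (m : ℤ)
    (c : ℕ → ∀ l l', (P.ι l →₀ A) →ₗ[Aᵐᵒᵖ] (P.ι l' →₀ A)) :
    AugmentedSequence.{u, v, w} (quotGrading 𝒜 f) where
  ι i := Σ s : Fin (i / 2 + 1), P.ι (i - 2 * s)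
  deg i x := P.deg (i - 2 * x.1) x.2 + (x.1 : ℕ) * m
  d i j := blockMatrix fun (s : Fin (i / 2 + 1)) (t : Fin (j / 2 + 1)) =>
    if (t : ℕ) ≤ s then
      mapEntries (quotMap f) (twist hr hn t (c (s - t) (i - 2 * s) (j - 2 * t)))
    else 0
  ε := ofColumns fun x => residueMap 𝒜 f
    (P.ε (Finsupp.single (cast (congrArg P.ι (Nat.zero_sub (2 * (x.1 : ℕ)))) x.2) 1))

end Construction

end Graded

end NormalQuotient

open NormalQuotient

/-! All `P_l` are gathered into one free module `F`, its basis vectors carrying a level `l`. A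
family `c^n` becomes one matrix `C_n` on `F`, and `E_n = C_n ∘ τ^n` is an additive semilinear map.
Since `f τ(a) = a f`, the scalar matrix `f·I` composed with `τ` is right multiplication by `f`,
called `ρ`; it is injective and commutes with every `E_n`. The homotopy equations, together with `d²
= 0`, become the untwisted identities `∑_{i+j=n} E_i E_j = δ_{n,1} ρ` in the ring of additive
endomorphisms (`semilinear_mul`, `semilinear_leftMul`).

Existence is obstruction theory (`exists_higher_homotopies`). If the identities hold below `n`,
associativity makes the n-th obstruction commute with `E_0` (`commute_obstruction`), so it is a
chain map from the twisted complex to the original one. It is null-homotopic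
(`exists_nullhomotopy`), because the complex is acyclic in positive levels and, for `n = 1`, because
`f` kills `k_A`. The null-homotopy is `C_n`.

For the resolution, an element of `T_i` lifts to a sequence `x_s` in `F` of levels `i - 2s`, with
s-th component `τ^s x_s` mod `f`; in these coordinates the differential is `D = ∑ E_n S^n`, where
`S` is the shift (`quotientSequence_d_toQuotient`), and `D² = ρ S` vanishes mod `f`. If `D x = ρ y`,
then `ρ D y = D² x = ρ S x`, so `D y = S x`. Prepending a suitable `a` to `y` gives `z` with `D z =
x`: all positive positions agree already, and the error in position 0 is an `E_0`-cycle of positive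
level (`exists_totalDiff_eq`). At `T_0` exactness comes from `P` and `k_A ≅ k_B`
(`residueMap_injective`).

In the Koszul case, comparison with a linear resolution puts the generators of the minimal `P_n` in
degree `n` (`AugmentedSequence.IsFreeResolution.isLinear`). The summand `s` of `T_i` is then
generated in degree `i + s(m - 2)`, and minimality and linearity are read off from degrees. -/

namespace NormalQuotient

/-! ### Matrices over a ring and change of coefficients -/

section Matrices

variable {A : Type*} [Ring A] {B : Type*} [Ring B] {ι κ μ : Type*}

@[simp]
theorem ofColumns_single {M : Type*} [AddCommGroup M] [Module Aᵐᵒᵖ M] (v : ι → M) (b : ι) (a : A) :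
    ofColumns v (Finsupp.single b a) = op a • v b :=
  Finsupp.sum_single_index (h := fun b a => op a • v b) (by rw [op_zero, zero_smul])

theorem single_eq_smul_one (b : ι) (a : A) :
    (Finsupp.single b a : ι →₀ A) = op a • Finsupp.single b 1 := by
  rw [Finsupp.smul_single, op_smul_eq_mul, one_mul]

theorem linearMap_ext {M : Type*} [AddCommGroup M] [Module Aᵐᵒᵖ M]
    {φ ψ : (ι →₀ A) →ₗ[Aᵐᵒᵖ] M}
    (h : ∀ b, φ (Finsupp.single b 1) = ψ (Finsupp.single b 1)) : φ = ψ := by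
  refine Finsupp.lhom_ext fun b a => ?_
  rw [single_eq_smul_one, map_smul, map_smul, h]

theorem apply_eq_sum (φ : (ι →₀ A) →ₗ[Aᵐᵒᵖ] (κ →₀ A)) (x : ι →₀ A) (a : κ) :
    φ x a = x.sum fun b r => φ (Finsupp.single b 1) a * r := by
  induction x using Finsupp.induction_linear with
  | zero => simp
  | add x y hx hy =>
    classical
    rw [map_add, Finsupp.add_apply, hx, hy, Finsupp.sum_add_index] <;> simp [mul_add]
  | single b r =>
    rw [Finsupp.sum_single_index (by simp), single_eq_smul_one, map_smul]
    rfl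

/-- Apply a ring homomorphism to all coefficients of a column vector. -/
noncomputable def mapCoeff (g : A →+* B) : (ι →₀ A) →+ (ι →₀ B) :=
  Finsupp.mapRange.addMonoidHom g.toAddMonoidHom

@[simp]
theorem mapCoeff_apply (g : A →+* B) (x : ι →₀ A) (b : ι) : mapCoeff g x b = g (x b) := rfl

@[simp]
theorem mapCoeff_single (g : A →+* B) (b : ι) (a : A) :
    mapCoeff g (Finsupp.single b a) = Finsupp.single b (g a) :=
  Finsupp.mapRange_single (hf := g.map_zero)

theorem mapCoeff_smul (g : A →+* B) (a : A) (x : ι →₀ A) :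
    mapCoeff g (op a • x) = op (g a) • mapCoeff g x := by
  ext b
  simp

theorem mapCoeff_mapDomain (g : A →+* B) (e : ι → κ) (x : ι →₀ A) :
    mapCoeff g (x.mapDomain e) = (mapCoeff g x).mapDomain e := by
  induction x using Finsupp.induction_linear with
  | zero => simp
  | add x y hx hy => simp [Finsupp.mapDomain_add, hx, hy]
  | single b r => simp [Finsupp.mapDomain_single]

theorem mapCoeff_surjective {g : A →+* B} (hg : Function.Surjective g) :
    Function.Surjective (mapCoeff g : (ι →₀ A) →+ (ι →₀ B)) :=
  Finsupp.mapRange_surjective g g.map_zero hg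

theorem mapEntries_single (g : A →+* B) (φ : (ι →₀ A) →ₗ[Aᵐᵒᵖ] (κ →₀ A)) (b : ι) :
    mapEntries g φ (Finsupp.single b 1) = mapCoeff g (φ (Finsupp.single b 1)) := by
  rw [mapEntries, ofColumns_single, op_one, one_smul]
  rfl

/-- By linearity only basis vectors matter. Both the twist and the base change to `B` are computed
through this intertwining relation. -/
theorem mapEntries_mapCoeff (g : A →+* B) (φ : (ι →₀ A) →ₗ[Aᵐᵒᵖ] (κ →₀ A)) (x : ι →₀ A) :
    mapEntries g φ (mapCoeff g x) = mapCoeff g (φ x) := by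
  induction x using Finsupp.induction_linear with
  | zero => simp
  | add x y hx hy => simp [hx, hy]
  | single b r =>
    rw [mapCoeff_single, single_eq_smul_one, map_smul, mapEntries_single, single_eq_smul_one b r,
      map_smul, mapCoeff_smul]

theorem leftMul_single (f : A) (b : ι) :
    leftMul ι f (Finsupp.single b 1) = Finsupp.single b f := by
  rw [leftMul, ofColumns_single, op_one, one_smul]

end Matrices

/-! ### The twist `τ^n` and semilinear maps `φ ∘ τ^n` -/

section Twist

variable {A : Type*} [Ring A] {f : A} (hr : IsRegularElt f) (hn : IsNormalElt f) {ι κ μ : Type*}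

/-- The `n`-th power of `τ = σ⁻¹`. -/
noncomputable def twistHom (n : ℕ) : A →+* A :=
  (((normalizingAut hr hn)⁻¹ ^ n : RingAut A) : A →+* A)

theorem twistHom_add (i j : ℕ) (a : A) :
    twistHom hr hn (i + j) a = twistHom hr hn i (twistHom hr hn j a) := by
  simp only [twistHom, pow_add]
  rfl

@[simp]
theorem twistHom_zero (a : A) : twistHom hr hn 0 a = a := rfl

theorem twistHom_bijective (n : ℕ) : Function.Bijective (twistHom hr hn n) :=
  RingEquiv.bijective ((normalizingAut hr hn)⁻¹ ^ n : RingAut A)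

theorem mul_twistHom_one (a : A) : f * twistHom hr hn 1 a = a * f := by
  rw [normalizingAut_spec hr hn]
  congr 1
  have : twistHom hr hn 1 a = (normalizingAut hr hn).symm a := by
    simp only [twistHom, pow_one]
    rfl
  rw [this]
  exact (normalizingAut hr hn).apply_symm_apply a

/-- From `f τ(f) = f f`, cancel `f` on the left. -/
theorem twistHom_self (n : ℕ) : twistHom hr hn n f = f := by
  induction n with
  | zero => rfl
  | succ n ih =>
    rw [twistHom_add]
    have : twistHom hr hn 1 f = f := hr.left_cancel (mul_twistHom_one hr hn f)
    rw [this, ih]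

theorem twist_mapCoeff (n : ℕ) (φ : (ι →₀ A) →ₗ[Aᵐᵒᵖ] (κ →₀ A)) (x : ι →₀ A) :
    twist hr hn n φ (mapCoeff (twistHom hr hn n) x) = mapCoeff (twistHom hr hn n) (φ x) :=
  mapEntries_mapCoeff _ φ x

theorem twist_single (n : ℕ) (φ : (ι →₀ A) →ₗ[Aᵐᵒᵖ] (κ →₀ A)) (b : ι) :
    twist hr hn n φ (Finsupp.single b 1) = mapCoeff (twistHom hr hn n) (φ (Finsupp.single b 1)) :=
  mapEntries_single _ φ b

theorem twist_zero (φ : (ι →₀ A) →ₗ[Aᵐᵒᵖ] (κ →₀ A)) : twist hr hn 0 φ = φ := by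
  refine linearMap_ext fun b => ?_
  rw [twist_single]
  ext a
  simp

theorem twist_zero_map (n : ℕ) : twist hr hn n (0 : (ι →₀ A) →ₗ[Aᵐᵒᵖ] (κ →₀ A)) = 0 := by
  refine linearMap_ext fun b => ?_
  rw [twist_single]
  simp

theorem mapCoeff_twistHom_add (i j : ℕ) (x : ι →₀ A) :
    mapCoeff (twistHom hr hn (i + j)) x =
      mapCoeff (twistHom hr hn i) (mapCoeff (twistHom hr hn j) x) := by
  ext b
  simp [twistHom_add]

/-- Coordinatewise this is `f τ(a) = a f`. It trades the scalar matrix, which is not central, for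
right multiplication by `f`, which commutes with every matrix. -/
theorem leftMul_mapCoeff_twistHom (x : ι →₀ A) :
    leftMul ι f (mapCoeff (twistHom hr hn 1) x) = op f • x := by
  induction x using Finsupp.induction_linear with
  | zero => simp
  | add x y hx hy => simp [hx, hy]
  | single b r =>
    rw [mapCoeff_single, single_eq_smul_one, map_smul, leftMul_single]
    simp [mul_twistHom_one]

/-- The semilinear endomorphism `φ ∘ τⁿ` attached to a matrix `φ`. -/
noncomputable def semilinear (n : ℕ) (φ : (ι →₀ A) →ₗ[Aᵐᵒᵖ] (ι →₀ A)) :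
    AddMonoid.End (ι →₀ A) :=
  φ.toAddMonoidHom.comp (mapCoeff (twistHom hr hn n))

theorem semilinear_apply (n : ℕ) (φ : (ι →₀ A) →ₗ[Aᵐᵒᵖ] (ι →₀ A)) (x : ι →₀ A) :
    semilinear hr hn n φ x = φ (mapCoeff (twistHom hr hn n) x) := rfl

/-- Moving `τ^i` past a matrix twists its entries. Twisted products of matrices thereby become
ordinary products of endomorphisms, where associativity is free. -/
theorem semilinear_mul (i j : ℕ) (φ ψ : (ι →₀ A) →ₗ[Aᵐᵒᵖ] (ι →₀ A)) :
    semilinear hr hn i φ * semilinear hr hn j ψ =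
      semilinear hr hn (i + j) (φ ∘ₗ twist hr hn i ψ) := by
  refine DFunLike.ext _ _ fun x => ?_
  rw [AddMonoid.End.coe_mul, Function.comp_apply, semilinear_apply, semilinear_apply,
    semilinear_apply, mapCoeff_twistHom_add, LinearMap.comp_apply, twist_mapCoeff]

theorem semilinear_add (n : ℕ) (φ ψ : (ι →₀ A) →ₗ[Aᵐᵒᵖ] (ι →₀ A)) :
    semilinear hr hn n (φ + ψ) = semilinear hr hn n φ + semilinear hr hn n ψ := rfl

theorem semilinear_zero (n : ℕ) :
    semilinear hr hn n (0 : (ι →₀ A) →ₗ[Aᵐᵒᵖ] (ι →₀ A)) = 0 := rfl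

theorem semilinear_neg (n : ℕ) (φ : (ι →₀ A) →ₗ[Aᵐᵒᵖ] (ι →₀ A)) :
    semilinear hr hn n (-φ) = -semilinear hr hn n φ := rfl

theorem semilinear_sum (n : ℕ) {S : Type*} (s : Finset S)
    (φ : S → (ι →₀ A) →ₗ[Aᵐᵒᵖ] (ι →₀ A)) :
    semilinear hr hn n (∑ i ∈ s, φ i) = ∑ i ∈ s, semilinear hr hn n (φ i) := by
  classical
  induction s using Finset.induction_on with
  | empty => simp [semilinear_zero]
  | insert a s ha ih => rw [Finset.sum_insert ha, Finset.sum_insert ha, semilinear_add, ih]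

theorem semilinear_injective (n : ℕ) :
    Function.Injective (semilinear hr hn n : ((ι →₀ A) →ₗ[Aᵐᵒᵖ] (ι →₀ A)) → _) := by
  intro φ ψ h
  refine LinearMap.ext fun x => ?_
  obtain ⟨y, rfl⟩ := mapCoeff_surjective (twistHom_bijective hr hn n).2 x
  exact DFunLike.congr_fun h y

end Twist

/-! ### Right multiplication by `f` -/

section RightMul

variable {A : Type*} [Ring A] {f : A} {ι : Type*}

/-- Right multiplication by `f` on column vectors. -/
noncomputable def rightMul (ι : Type*) (f : A) : AddMonoid.End (ι →₀ A) :=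
  DistribSMul.toAddMonoidHom (ι →₀ A) (op f)

@[simp]
theorem rightMul_apply (x : ι →₀ A) : rightMul ι f x = op f • x := rfl

theorem semilinear_leftMul (hr : IsRegularElt f) (hn : IsNormalElt f) :
    semilinear hr hn 1 (leftMul ι f) = rightMul ι f := by
  refine DFunLike.ext _ _ fun x => ?_
  exact leftMul_mapCoeff_twistHom hr hn x

/-- `φ` is right linear and `τ^n` fixes `f`. -/
theorem semilinear_comm_rightMul (hr : IsRegularElt f) (hn : IsNormalElt f) (n : ℕ)
    (φ : (ι →₀ A) →ₗ[Aᵐᵒᵖ] (ι →₀ A)) :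
    semilinear hr hn n φ * rightMul ι f = rightMul ι f * semilinear hr hn n φ := by
  refine DFunLike.ext _ _ fun x => ?_
  simp [semilinear_apply, mapCoeff_smul, twistHom_self]

theorem rightMul_injective (hr : IsRegularElt f) : Function.Injective (rightMul ι f) := by
  intro x y h
  ext b
  exact hr.right_cancel (by simpa using DFunLike.congr_fun h b)

end RightMul

/-! ### Homogeneous components and the augmentation ideal -/

section Grading

variable {k : Type*} [Field k] {A : Type*} [Ring A] [Algebra k A]
  (𝒜 : ℤ → Submodule k A) [GradedAlgebra 𝒜]

theorem mem_of_decompose_eq_zero {a : A} {i : ℤ}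
    (h : ∀ j, j ≠ i → (DirectSum.decompose 𝒜 a j : A) = 0) : a ∈ 𝒜 i := by
  classical
  rw [← DirectSum.sum_support_decompose 𝒜 a]
  refine Submodule.sum_mem _ fun j _ => ?_
  by_cases hj : j = i
  · exact hj ▸ SetLike.coe_mem _
  · rw [h j hj]
    exact Submodule.zero_mem _

/-- Compare components in `f τ(a) = a f`: the right side is homogeneous, so `f` kills every
component of `τ(a)` outside degree `i`, and regularity applies. -/
theorem twistHom_mem {m : ℤ} {f : A} (hfm : f ∈ 𝒜 m) (hr : IsRegularElt f) (hn : IsNormalElt f)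
    (n : ℕ) {a : A} {i : ℤ} (ha : a ∈ 𝒜 i) : twistHom hr hn n a ∈ 𝒜 i := by
  induction n generalizing a with
  | zero => exact ha
  | succ n ih =>
    rw [twistHom_add]
    refine ih (mem_of_decompose_eq_zero 𝒜 fun j hj => hr _ (Or.inr ?_))
    rw [← DirectSum.coe_decompose_mul_add_of_left_mem 𝒜 hfm, mul_twistHom_one,
      DirectSum.decompose_of_mem_ne 𝒜 (SetLike.mul_mem_graded ha hfm)]
    omega

variable {𝒜}

omit [GradedAlgebra 𝒜] in
theorem IsConnectedGraded.eq_zero_of_neg (hA : IsConnectedGraded 𝒜) {a : A} {i : ℤ} (hi : i < 0)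
    (ha : a ∈ 𝒜 i) : a = 0 := by
  rw [hA.neg i hi] at ha
  exact ha

omit [GradedAlgebra 𝒜] in
theorem mem_augIdeal_of_mem {a : A} {i : ℤ} (hi : 1 ≤ i) (ha : a ∈ 𝒜 i) : a ∈ augIdeal 𝒜 :=
  Submodule.subset_span ⟨i, hi, ha⟩

omit [GradedAlgebra 𝒜] in
theorem mul_mem_augIdeal_right {a : A} (ha : a ∈ augIdeal 𝒜) (b : A) : a * b ∈ augIdeal 𝒜 :=
  (augIdeal 𝒜).smul_mem (op b) ha

/-- `A_{≥1}` was defined as a right ideal; it is also a left ideal because `A` has no negative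
degrees. -/
theorem mul_mem_augIdeal (hA : IsConnectedGraded 𝒜) (a : A) {b : A} (hb : b ∈ augIdeal 𝒜) :
    a * b ∈ augIdeal 𝒜 := by
  classical
  induction hb using Submodule.span_induction with
  | mem b hb =>
    obtain ⟨i, hi, hb⟩ := hb
    rw [← DirectSum.sum_support_decompose 𝒜 a, Finset.sum_mul]
    refine Submodule.sum_mem _ fun j _ => ?_
    by_cases hj : j < 0
    · rw [hA.eq_zero_of_neg hj (SetLike.coe_mem _), zero_mul]
      exact Submodule.zero_mem _
    · exact mem_augIdeal_of_mem (by omega) (SetLike.mul_mem_graded (SetLike.coe_mem _) hb)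
  | zero => simp
  | add x y _ _ hx hy =>
    rw [mul_add]
    exact Submodule.add_mem _ hx hy
  | smul r x _ hx =>
    rw [mul_smul_comm]
    exact Submodule.smul_mem _ r hx

theorem decompose_zero_eq_zero_of_mem_augIdeal (hA : IsConnectedGraded 𝒜) {a : A}
    (ha : a ∈ augIdeal 𝒜) : (DirectSum.decompose 𝒜 a 0 : A) = 0 := by
  -- Allowing an arbitrary right factor lets the span induction pass through scalar multiples.
  suffices h : ∀ r : A, (DirectSum.decompose 𝒜 (a * r) 0 : A) = 0 by simpa using h 1
  induction ha using Submodule.span_induction with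
  | mem a ha =>
    obtain ⟨i, hi, ha⟩ := ha
    intro r
    have := DirectSum.coe_decompose_mul_add_of_left_mem 𝒜 (j := -i) (b := r) ha
    rw [add_neg_cancel] at this
    rw [this, hA.eq_zero_of_neg (i := -i) (by omega) (SetLike.coe_mem _), mul_zero]
  | zero => simp
  | add x y _ _ hx hy =>
    intro r
    rw [add_mul, DirectSum.decompose_add, DirectSum.add_apply, Submodule.coe_add, hx, hy, add_zero]
  | smul s x _ hx =>
    intro r
    have : s • x * r = x * (s.unop * r) := by rw [← mul_assoc]; rfl
    rw [this, hx]

theorem one_notMem_augIdeal (hA : IsConnectedGraded 𝒜) : (1 : A) ∉ augIdeal 𝒜 := by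
  intro h
  have h1 := decompose_zero_eq_zero_of_mem_augIdeal hA h
  rw [DirectSum.decompose_of_mem_same 𝒜 (SetLike.GradedOne.one_mem)] at h1
  have := hA.injective.nontrivial
  exact one_ne_zero h1

omit [GradedAlgebra 𝒜] in
theorem eq_zero_of_mem_trivialGrading (hA : IsConnectedGraded 𝒜) {p : ℤ} (hp : p ≠ 0)
    {x : TrivialModule 𝒜} (hx : x ∈ trivialGrading 𝒜 p) : x = 0 := by
  obtain ⟨a, ha, rfl⟩ := hx
  rcases lt_or_gt_of_ne hp with hp | hp
  · rw [hA.eq_zero_of_neg hp ha, map_zero]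
  · rw [Submodule.mkQ_apply, Submodule.Quotient.mk_eq_zero]
    exact mem_augIdeal_of_mem (by omega) ha

/-- The homogeneous component of degree `p` of a column vector, where the basis vector `b` has
degree `deg b`. -/
noncomputable def homComponent {ι : Type*} (deg : ι → ℤ) (p : ℤ) : (ι →₀ A) →+ (ι →₀ A) where
  toFun x := Finsupp.onFinset x.support
    (fun b => (DirectSum.decompose 𝒜 (x b) (p - deg b) : A)) (by
      intro b hb
      rw [Finsupp.mem_support_iff]
      rintro h
      exact hb (by rw [h, DirectSum.decompose_zero]; rfl))
  map_zero' := by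
    ext b
    simp
  map_add' x y := by
    ext b
    simp

theorem homComponent_apply {ι : Type*} (deg : ι → ℤ) (p : ℤ) (x : ι →₀ A) (b : ι) :
    homComponent (𝒜 := 𝒜) deg p x b = (DirectSum.decompose 𝒜 (x b) (p - deg b) : A) := rfl

theorem apply_homComponent {ι κ : Type*} (deg : ι → ℤ) (deg' : κ → ℤ)
    (φ : (ι →₀ A) →ₗ[Aᵐᵒᵖ] (κ →₀ A))
    (hφ : ∀ b a, φ (Finsupp.single b 1) a ∈ 𝒜 (deg b - deg' a)) (p : ℤ) (x : ι →₀ A) :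
    φ (homComponent (𝒜 := 𝒜) deg p x) = homComponent (𝒜 := 𝒜) deg' p (φ x) := by
  classical
  induction x using Finsupp.induction_linear with
  | zero => simp
  | add x y hx hy => simp [hx, hy]
  | single b r =>
    have : homComponent (𝒜 := 𝒜) deg p (Finsupp.single b r) =
        Finsupp.single b (DirectSum.decompose 𝒜 r (p - deg b) : A) := by
      ext c
      rw [homComponent_apply]
      by_cases h : b = c
      · subst h
        simp
      · rw [Finsupp.single_eq_of_ne' h, Finsupp.single_eq_of_ne' h]
        simp
    rw [this, single_eq_smul_one, single_eq_smul_one b r, map_smul, map_smul]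
    ext a
    rw [homComponent_apply]
    change _ * _ = (DirectSum.decompose 𝒜 (_ * _) _ : A)
    have e : p - deg' a = (deg b - deg' a) + (p - deg b) := by omega
    rw [e, DirectSum.coe_decompose_mul_add_of_left_mem 𝒜 (hφ b a)]
    rfl

/-- A degree-preserving map commutes with taking components, so the degree `p` component of any
preimage is still a preimage. -/
theorem exists_homogeneous_preimage {ι κ : Type*} (deg : ι → ℤ) (deg' : κ → ℤ)
    (φ : (ι →₀ A) →ₗ[Aᵐᵒᵖ] (κ →₀ A))
    (hφ : ∀ b a, φ (Finsupp.single b 1) a ∈ 𝒜 (deg b - deg' a)) {p : ℤ} {x : ι →₀ A}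
    {y : κ →₀ A} (hx : φ x = y) (hy : ∀ a, y a ∈ 𝒜 (p - deg' a)) :
    ∃ z, φ z = y ∧ ∀ b, z b ∈ 𝒜 (p - deg b) := by
  refine ⟨homComponent (𝒜 := 𝒜) deg p x, ?_, fun b => SetLike.coe_mem _⟩
  rw [apply_homComponent deg deg' φ hφ, hx]
  ext a
  rw [homComponent_apply, DirectSum.decompose_of_mem_same 𝒜 (hy a)]

end Grading

/-! ### Levels, degrees and homogeneous maps on one total free module -/

section Homogeneous

variable {k : Type*} [Field k] {A : Type*} [Ring A] [Algebra k A]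
  (𝒜 : ℤ → Submodule k A) [GradedAlgebra 𝒜] {J : Type*} (lev : J → ℕ) (deg : J → ℤ)

/-- Column vectors supported on the basis vectors of level `L`. -/
def levelPart (A : Type*) [Ring A] {J : Type*} (lev : J → ℕ) (L : ℤ) : AddSubgroup (J →₀ A) where
  carrier := {x | ∀ j, (lev j : ℤ) ≠ L → x j = 0}
  zero_mem' _ _ := rfl
  add_mem' hx hy j hj := by rw [Finsupp.add_apply, hx j hj, hy j hj, add_zero]
  neg_mem' hx j hj := by rw [Finsupp.neg_apply, hx j hj, neg_zero]

/-- Column vectors of level `L` and degree `p`. -/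
def homPart (L p : ℤ) : AddSubgroup (J →₀ A) where
  carrier := {x | x ∈ levelPart A lev L ∧ ∀ j, x j ∈ 𝒜 (p - deg j)}
  zero_mem' := ⟨zero_mem _, fun _ => zero_mem _⟩
  add_mem' hx hy := ⟨add_mem hx.1 hy.1, fun j => add_mem (hx.2 j) (hy.2 j)⟩
  neg_mem' hx := ⟨neg_mem hx.1, fun j => neg_mem (hx.2 j)⟩

/-- Matrices raising the level by `r` and the degree by `q`. -/
def IsHomogeneousMap (r q : ℤ) (φ : (J →₀ A) →ₗ[Aᵐᵒᵖ] (J →₀ A)) : Prop :=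
  ∀ j, φ (Finsupp.single j 1) ∈ homPart 𝒜 lev deg (lev j + r) (deg j + q)

variable {𝒜 lev deg}

omit [GradedAlgebra 𝒜] in
theorem levelPart_induction {L : ℤ} {p : (J →₀ A) → Prop} (h0 : p 0)
    (hadd : ∀ x y, p x → p y → p (x + y)) (hs : ∀ j a, (lev j : ℤ) = L → p (Finsupp.single j a))
    {x : J →₀ A} (hx : x ∈ levelPart A lev L) : p x := by
  rw [← Finsupp.sum_single x]
  refine Finset.sum_induction _ p hadd h0 fun j hj => hs j _ ?_
  by_contra h
  exact (Finsupp.mem_support_iff.mp hj) (hx j h)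

/-- Levels are integers in the statements but natural numbers on the basis; this plays the role of
the convention `P_i = 0` for `i < 0`. -/
theorem eq_zero_of_mem_levelPart_of_neg {L : ℤ} (hL : L < 0) {x : J →₀ A}
    (hx : x ∈ levelPart A lev L) : x = 0 := by
  ext j
  exact hx j (by omega)

theorem map_mem_levelPart {r : ℤ} {φ : (J →₀ A) →ₗ[Aᵐᵒᵖ] (J →₀ A)}
    (hφ : ∀ j, φ (Finsupp.single j 1) ∈ levelPart A lev (lev j + r)) {L : ℤ} {x : J →₀ A}
    (hx : x ∈ levelPart A lev L) : φ x ∈ levelPart A lev (L + r) := by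
  refine levelPart_induction (p := fun x => φ x ∈ levelPart A lev (L + r)) (by simp)
    (fun x y hx hy => by rw [map_add]; exact add_mem hx hy) (fun j a hj => ?_) hx
  rw [single_eq_smul_one, map_smul]
  intro i hi
  rw [Finsupp.smul_apply, hφ j i (by rwa [hj]), smul_zero]

theorem IsHomogeneousMap.map_mem {r q : ℤ} {φ : (J →₀ A) →ₗ[Aᵐᵒᵖ] (J →₀ A)}
    (hφ : IsHomogeneousMap 𝒜 lev deg r q φ) {L p : ℤ} {x : J →₀ A}
    (hx : x ∈ homPart 𝒜 lev deg L p) : φ x ∈ homPart 𝒜 lev deg (L + r) (p + q) := by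
  refine ⟨map_mem_levelPart (fun j => (hφ j).1) hx.1, fun i => ?_⟩
  rw [apply_eq_sum]
  refine Submodule.sum_mem _ fun j _ => ?_
  have := SetLike.mul_mem_graded ((hφ j).2 i) (hx.2 j)
  convert this using 2
  omega

theorem IsHomogeneousMap.comp {r q r' q' : ℤ} {φ ψ : (J →₀ A) →ₗ[Aᵐᵒᵖ] (J →₀ A)}
    (hφ : IsHomogeneousMap 𝒜 lev deg r q φ) (hψ : IsHomogeneousMap 𝒜 lev deg r' q' ψ) :
    IsHomogeneousMap 𝒜 lev deg (r + r') (q + q') (φ ∘ₗ ψ) := by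
  intro j
  rw [add_comm r, add_comm q, ← add_assoc, ← add_assoc]
  exact hφ.map_mem (hψ j)

omit [GradedAlgebra 𝒜] in
theorem IsHomogeneousMap.neg {r q : ℤ} {φ : (J →₀ A) →ₗ[Aᵐᵒᵖ] (J →₀ A)}
    (hφ : IsHomogeneousMap 𝒜 lev deg r q φ) : IsHomogeneousMap 𝒜 lev deg r q (-φ) :=
  fun j => neg_mem (hφ j)

omit [GradedAlgebra 𝒜] in
theorem IsHomogeneousMap.add {r q : ℤ} {φ ψ : (J →₀ A) →ₗ[Aᵐᵒᵖ] (J →₀ A)}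
    (hφ : IsHomogeneousMap 𝒜 lev deg r q φ) (hψ : IsHomogeneousMap 𝒜 lev deg r q ψ) :
    IsHomogeneousMap 𝒜 lev deg r q (φ + ψ) :=
  fun j => add_mem (hφ j) (hψ j)

omit [GradedAlgebra 𝒜] in
theorem IsHomogeneousMap.sum {r q : ℤ} {S : Type*} (s : Finset S)
    {φ : S → (J →₀ A) →ₗ[Aᵐᵒᵖ] (J →₀ A)}
    (hφ : ∀ i ∈ s, IsHomogeneousMap 𝒜 lev deg r q (φ i)) :
    IsHomogeneousMap 𝒜 lev deg r q (∑ i ∈ s, φ i) := by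
  intro j
  rw [LinearMap.sum_apply]
  exact sum_mem fun i hi => hφ i hi j

theorem mapCoeff_mem_levelPart (g : A →+* A) {L : ℤ} {x : J →₀ A} (hx : x ∈ levelPart A lev L) :
    mapCoeff g x ∈ levelPart A lev L :=
  fun j hj => by rw [mapCoeff_apply, hx j hj, map_zero]

theorem IsHomogeneousMap.twist {m : ℤ} {f : A} (hfm : f ∈ 𝒜 m) (hr : IsRegularElt f)
    (hn : IsNormalElt f) (n : ℕ) {r q : ℤ} {φ : (J →₀ A) →ₗ[Aᵐᵒᵖ] (J →₀ A)}
    (hφ : IsHomogeneousMap 𝒜 lev deg r q φ) :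
    IsHomogeneousMap 𝒜 lev deg r q (twist hr hn n φ) := by
  intro j
  rw [twist_single]
  exact ⟨mapCoeff_mem_levelPart _ (hφ j).1, fun i => twistHom_mem 𝒜 hfm hr hn n ((hφ j).2 i)⟩

omit [GradedAlgebra 𝒜] in
theorem isHomogeneousMap_leftMul {m : ℤ} {f : A} (hfm : f ∈ 𝒜 m) :
    IsHomogeneousMap 𝒜 lev deg 0 m (leftMul J f) := by
  classical
  intro j
  rw [leftMul_single]
  refine ⟨fun i hi => Finsupp.single_eq_of_ne' fun h => hi (by rw [h, add_zero]), fun i => ?_⟩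
  by_cases h : j = i
  · subst h
    rw [Finsupp.single_eq_same, add_sub_cancel_left]
    exact hfm
  · rw [Finsupp.single_eq_of_ne' h]
    exact zero_mem _

end Homogeneous

/-! ### Recursive constructions by dependent choice -/

theorem exists_dependent_sequence {X : ℕ → Type*} (p : ∀ n, X n → Prop)
    (r : ∀ n, X n → X (n + 1) → Prop) (x₀ : X 0) (hx₀ : p 0 x₀)
    (hs : ∀ n x, p n x → ∃ y, p (n + 1) y ∧ r n x y) :
    ∃ g : ∀ n, X n, g 0 = x₀ ∧ (∀ n, p n (g n)) ∧ ∀ n, r n (g n) (g (n + 1)) := by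
  choose y hy using hs
  let G : ∀ n, { x : X n // p n x } := fun n =>
    Nat.rec (motive := fun n => { x : X n // p n x }) ⟨x₀, hx₀⟩
      (fun n x => ⟨y n x.1 x.2, (hy n x.1 x.2).1⟩) n
  exact ⟨fun n => (G n).1, rfl, fun n => (G n).2, fun n => (hy n (G n).1 (G n).2).2⟩

/-- Condition `p n` only sees the entries up to `n`, so a sequence can be corrected one entry at a
time; the i-th entry is final after stage `i + 1`, and the diagonal of the stages works. -/
theorem exists_sequence_of_extension {X : Type*} [Inhabited X] (p : ℕ → (ℕ → X) → Prop)
    (hp : ∀ n g g', (∀ i ≤ n, g i = g' i) → p n g → p n g')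
    (hs : ∀ n g, (∀ i < n, p i g) → ∃ x, p n (Function.update g n x)) :
    ∃ g, ∀ n, p n g := by
  obtain ⟨G, -, hG, hGG⟩ := exists_dependent_sequence (X := fun _ => ℕ → X)
    (fun N g => ∀ i < N, p i g) (fun N g g' => ∀ i < N, g' i = g i)
    default (by simp) (by
      intro N g hg
      obtain ⟨x, hx⟩ := hs N g hg
      refine ⟨Function.update g N x, fun i hi => ?_, fun i hi => ?_⟩
      · rcases Nat.lt_succ_iff_lt_or_eq.mp hi with h | rfl
        · refine hp i g _ (fun j hj => ?_) (hg i h)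
          rw [Function.update_of_ne (by omega)]
        · exact hx
      · rw [Function.update_of_ne (by omega)])
  have key : ∀ d i, G (i + 1 + d) i = G (i + 1) i := by
    intro d i
    induction d with
    | zero => rfl
    | succ d ih => rw [← ih, ← hGG (i + 1 + d) i (by omega)]; rfl
  refine ⟨fun i => G (i + 1) i, fun n => hp n (G (n + 1)) _ (fun i hi => ?_)
    (hG (n + 1) n (by omega))⟩
  obtain ⟨d, rfl⟩ := Nat.exists_eq_add_of_le hi
  rw [← key d i]
  congr 1
  omega

/-! ### Null-homotopies built level by level -/

section Nullhomotopy

variable {k : Type*} [Field k] {A : Type*} [Ring A] [Algebra k A]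
  {𝒜 : ℤ → Submodule k A} {J : Type*} {lev : J → ℕ} {deg : J → ℤ}

theorem eqOn_levelPart {L : ℤ} {φ ψ : (J →₀ A) →+ (J →₀ A)}
    (h : ∀ j a, (lev j : ℤ) = L → φ (Finsupp.single j a) = ψ (Finsupp.single j a))
    {x : J →₀ A} (hx : x ∈ levelPart A lev L) : φ x = ψ x :=
  levelPart_induction (p := fun x => φ x = ψ x) (by simp) (fun x y hx hy => by simp [hx, hy]) h hx

theorem eqOn_levelPart_of_single_one {L : ℤ} {φ ψ : (J →₀ A) →ₗ[Aᵐᵒᵖ] (J →₀ A)}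
    (h : ∀ j, (lev j : ℤ) = L → φ (Finsupp.single j 1) = ψ (Finsupp.single j 1))
    {x : J →₀ A} (hx : x ∈ levelPart A lev L) : φ x = ψ x :=
  eqOn_levelPart (φ := φ.toAddMonoidHom) (ψ := ψ.toAddMonoidHom) (fun j a hj => by
    change φ _ = ψ _
    rw [single_eq_smul_one, map_smul, map_smul, h j hj]) hx

/-- A homogeneous morphism `g` commuting with the differentials is null-homotopic when the target
is acyclic in the relevant degrees. -/
theorem exists_nullhomotopy {d d' g : (J →₀ A) →ₗ[Aᵐᵒᵖ] (J →₀ A)} {r q : ℤ}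
    (hd' : IsHomogeneousMap 𝒜 lev deg (-1) 0 d') (hdd' : d' ∘ₗ d' = 0) (hdg : d ∘ₗ g = g ∘ₗ d')
    (hg : IsHomogeneousMap 𝒜 lev deg r q g) [GradedAlgebra 𝒜]
    (h0 : ∀ j, lev j = 0 → ∃ y ∈ homPart 𝒜 lev deg (lev j + (r + 1)) (deg j + q),
      d y = g (Finsupp.single j 1))
    (hs : ∀ j, lev j ≠ 0 → ∀ x ∈ homPart 𝒜 lev deg (lev j + r) (deg j + q), d x = 0 →
      ∃ y ∈ homPart 𝒜 lev deg (lev j + (r + 1)) (deg j + q), d y = x) :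
    ∃ h, IsHomogeneousMap 𝒜 lev deg (r + 1) q h ∧ d ∘ₗ h + h ∘ₗ d' = g := by
  classical
  -- At stage `l` the homotopy identity holds on levels below `l`. The next stage changes values
  -- only on level `l`, which leaves the earlier identities intact because `d'` lowers levels.
  obtain ⟨G, -, hG, hGG⟩ := exists_dependent_sequence (X := fun _ => (J →₀ A) →ₗ[Aᵐᵒᵖ] (J →₀ A))
    (fun l h => IsHomogeneousMap 𝒜 lev deg (r + 1) q h ∧ ∀ j, lev j < l →
      (d ∘ₗ h + h ∘ₗ d') (Finsupp.single j 1) = g (Finsupp.single j 1))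
    (fun l h h' => ∀ j, lev j < l → h' (Finsupp.single j 1) = h (Finsupp.single j 1))
    0 ⟨fun j => by simp, by simp⟩ (by
      rintro l h ⟨hh, hhd⟩
      have key : ∀ j, ∃ y ∈ homPart 𝒜 lev deg (lev j + (r + 1)) (deg j + q),
          lev j = l → d y + h (d' (Finsupp.single j 1)) = g (Finsupp.single j 1) := by
        intro j
        by_cases hj : lev j = l
        swap
        · exact ⟨0, zero_mem _, fun h => absurd h hj⟩
        by_cases hl : lev j = 0
        · obtain ⟨y, hy, hyd⟩ := h0 j hl
          refine ⟨y, hy, fun _ => ?_⟩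
          rw [eq_zero_of_mem_levelPart_of_neg (by omega) (hd' j).1, map_zero, add_zero, hyd]
        · have h1 := hh.map_mem (hd' j)
          have e1 : (lev j : ℤ) + -1 + (r + 1) = lev j + r := by ring
          rw [e1, add_zero] at h1
          -- The value at `e_j` must lift `g e_j - h d' e_j`. This is a cycle: the identity one
          -- level down, applied to `d' e_j` with `d' d' = 0`, gives `d h d' e_j = g d' e_j = d g
          -- e_j`.
          obtain ⟨y, hy, hyd⟩ := hs j hl (g (Finsupp.single j 1) - h (d' (Finsupp.single j 1)))
            (sub_mem (hg j) h1) (by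
              have h2 : (d ∘ₗ h + h ∘ₗ d') (d' (Finsupp.single j 1)) =
                  g (d' (Finsupp.single j 1)) :=
                eqOn_levelPart_of_single_one (fun i hi => hhd i (by omega)) (hd' j).1
              have h3 : d' (d' (Finsupp.single j 1)) = 0 := LinearMap.congr_fun hdd' _
              have h4 : d (g (Finsupp.single j 1)) = g (d' (Finsupp.single j 1)) :=
                LinearMap.congr_fun hdg _
              rw [LinearMap.add_apply, LinearMap.comp_apply, LinearMap.comp_apply, h3, map_zero,
                add_zero] at h2
              rw [map_sub, h2, h4, sub_self])
          exact ⟨y, hy, fun _ => by rw [hyd, sub_add_cancel]⟩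
      choose y hy hyd using key
      let h' : (J →₀ A) →ₗ[Aᵐᵒᵖ] (J →₀ A) :=
        ofColumns fun j => if lev j = l then y j else h (Finsupp.single j 1)
      have h'_single : ∀ j, h' (Finsupp.single j 1) =
          if lev j = l then y j else h (Finsupp.single j 1) := fun j => by
        rw [ofColumns_single, op_one, one_smul]
      have hagree : ∀ j, lev j < l → h' (Finsupp.single j 1) = h (Finsupp.single j 1) :=
        fun j hj => by rw [h'_single, if_neg (by omega)]
      have hagree' : ∀ j, lev j ≤ l → h' (d' (Finsupp.single j 1)) =
          h (d' (Finsupp.single j 1)) := fun j hj =>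
        eqOn_levelPart_of_single_one (fun i hi => hagree i (by omega)) (hd' j).1
      refine ⟨h', ⟨fun j => ?_, fun j hj => ?_⟩, hagree⟩
      · rw [h'_single]
        split_ifs
        · exact hy j
        · exact hh j
      · rw [LinearMap.add_apply, LinearMap.comp_apply, LinearMap.comp_apply, hagree' j (by omega)]
        by_cases hjl : lev j = l
        · rw [h'_single, if_pos hjl, hyd j hjl]
        · rw [hagree j (by omega)]
          exact hhd j (by omega))
  have key : ∀ n j, G (lev j + 1 + n) (Finsupp.single j 1) =
      G (lev j + 1) (Finsupp.single j 1) := by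
    intro n j
    induction n with
    | zero => rfl
    | succ n ih => rw [← ih, ← hGG (lev j + 1 + n) j (by omega)]; rfl
  -- The stages stabilise on each level, so the limit takes its value at `e_j` from stage `lev j +
  -- 1`.
  let h : (J →₀ A) →ₗ[Aᵐᵒᵖ] (J →₀ A) := ofColumns fun j => G (lev j + 1) (Finsupp.single j 1)
  have h_single : ∀ j, h (Finsupp.single j 1) = G (lev j + 1) (Finsupp.single j 1) := fun j => by
    rw [ofColumns_single, op_one, one_smul]
  refine ⟨h, fun j => by rw [h_single]; exact (hG _).1 j, linearMap_ext fun j => ?_⟩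
  rw [← (hG (lev j + 1)).2 j (by omega), LinearMap.add_apply, LinearMap.add_apply,
    LinearMap.comp_apply, LinearMap.comp_apply, LinearMap.comp_apply, LinearMap.comp_apply,
    h_single]
  congr 1
  refine eqOn_levelPart_of_single_one (fun i hi => ?_) (hd' j).1
  have := key 1 i
  rw [h_single, ← this]
  congr 2
  omega

end Nullhomotopy

/-! ### The associativity argument for obstructions -/

section Convolution

variable {R : Type*} [Ring R]

/-- This is the coefficient of `t^n` in `e(t)·e(t)² = e(t)²·e(t)` for the power series `e(t) = ∑ e_i
t^i`. -/
theorem sum_antidiagonal_mul_assoc (e : ℕ → R) (n : ℕ) :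
    ∑ p ∈ Finset.HasAntidiagonal.antidiagonal n,
        e p.1 * ∑ q ∈ Finset.HasAntidiagonal.antidiagonal p.2, e q.1 * e q.2 =
      ∑ p ∈ Finset.HasAntidiagonal.antidiagonal n,
        (∑ q ∈ Finset.HasAntidiagonal.antidiagonal p.1, e q.1 * e q.2) * e p.2 := by
  have h := congrArg (PowerSeries.coeff n)
    (mul_assoc (PowerSeries.mk e) (PowerSeries.mk e) (PowerSeries.mk e))
  simp only [PowerSeries.coeff_mul, PowerSeries.coeff_mk] at h
  exact h.symm

/-- The obstruction to extending a solution of `∑ e_i e_j = δ_{n,1} ρ` commutes with `e_0`. -/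
theorem commute_obstruction (e : ℕ → R) (ρ : R) (n : ℕ) (hn : 1 ≤ n)
    (hρ : ∀ i, e i * ρ = ρ * e i)
    (h : ∀ i < n, ∑ p ∈ Finset.HasAntidiagonal.antidiagonal i, e p.1 * e p.2 =
      if i = 1 then ρ else 0) :
    e 0 * ((if n = 1 then ρ else 0) - ∑ p ∈ Finset.HasAntidiagonal.antidiagonal n, e p.1 * e p.2) =
      ((if n = 1 then ρ else 0) - ∑ p ∈ Finset.HasAntidiagonal.antidiagonal n, e p.1 * e p.2) *
        e 0 := by
  have key := sum_antidiagonal_mul_assoc e n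
  generalize hq : (fun i => ∑ p ∈ Finset.HasAntidiagonal.antidiagonal i, e p.1 * e p.2) = q at *
  have hq' : ∀ i, ∑ p ∈ Finset.HasAntidiagonal.antidiagonal i, e p.1 * e p.2 = q i :=
    fun i => congrFun hq i
  simp only [hq'] at key h ⊢
  obtain ⟨n, rfl⟩ : ∃ l, n = l + 1 := ⟨n - 1, by omega⟩
  -- Isolate `e_0 q_n` and `q_n e_0`. Every other term contains some `q_i` with `i < n`, which is
  -- `ρ` or `0` and hence commutes with all `e_j`, so the remaining sums cancel.
  rw [Finset.Nat.sum_antidiagonal_succ, Finset.Nat.sum_antidiagonal_succ'] at key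
  have h3 : ∑ p ∈ Finset.HasAntidiagonal.antidiagonal n, e (p.1 + 1) * q p.2 =
      ∑ p ∈ Finset.HasAntidiagonal.antidiagonal n, q p.1 * e (p.2 + 1) := by
    rw [← Finset.Nat.sum_antidiagonal_swap]
    refine Finset.sum_congr rfl fun p hp => ?_
    rw [Finset.HasAntidiagonal.mem_antidiagonal] at hp
    rw [Prod.fst_swap, Prod.snd_swap, h _ (by omega)]
    split_ifs
    · exact hρ _
    · simp
  rw [h3] at key
  rw [mul_sub, sub_mul, add_right_cancel key]
  congr 1
  split_ifs
  · exact hρ 0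
  · rw [mul_zero, zero_mul]

end Convolution

theorem twist_comp {A : Type*} [Ring A] {f : A} (hr : IsRegularElt f) (hn : IsNormalElt f)
    {ι κ μ : Type*} (n : ℕ) (φ : (κ →₀ A) →ₗ[Aᵐᵒᵖ] (μ →₀ A)) (ψ : (ι →₀ A) →ₗ[Aᵐᵒᵖ] (κ →₀ A)) :
    twist hr hn n (φ ∘ₗ ψ) = twist hr hn n φ ∘ₗ twist hr hn n ψ := by
  refine linearMap_ext fun b => ?_
  rw [LinearMap.comp_apply, twist_single, twist_single, twist_mapCoeff, LinearMap.comp_apply]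

theorem sum_antidiagonal_ite_fst {M : Type*} [AddCommMonoid M] (n : ℕ) (x : M) :
    ∑ p ∈ Finset.HasAntidiagonal.antidiagonal n, (if p.1 = 0 then x else 0) = x := by
  rw [Finset.Nat.sum_antidiagonal_eq_sum_range_succ (fun i _ => if i = 0 then x else 0)]
  simp

theorem sum_antidiagonal_ite_snd {M : Type*} [AddCommMonoid M] (n : ℕ) (x : M) :
    ∑ p ∈ Finset.HasAntidiagonal.antidiagonal n, (if p.2 = 0 then x else 0) = x := by
  rw [← Finset.Nat.sum_antidiagonal_swap]
  exact sum_antidiagonal_ite_fst n x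

/-! ### Existence of higher homotopies on the total module -/

section HigherHomotopies

variable {k : Type*} [Field k] {A : Type*} [Ring A] [Algebra k A]
  {𝒜 : ℤ → Submodule k A} [GradedAlgebra 𝒜] {J : Type*} {lev : J → ℕ} {deg : J → ℤ}
  {m : ℤ} {f : A}

/-- On an acyclic complex of graded free modules with differential `d` on which `f` is
null-homotopic in level `0`, the equations `∑ C_i (τ^i C_j) = δ_{n,1} f` can be solved
with `C_0 = d`. -/
theorem exists_higher_homotopies (hfm : f ∈ 𝒜 m) (hr : IsRegularElt f) (hn : IsNormalElt f)
    {d : (J →₀ A) →ₗ[Aᵐᵒᵖ] (J →₀ A)} (hd : IsHomogeneousMap 𝒜 lev deg (-1) 0 d)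
    (hdd : d ∘ₗ d = 0)
    (hexact : ∀ L p : ℤ, 1 ≤ L → ∀ x ∈ homPart 𝒜 lev deg L p, d x = 0 →
      ∃ y ∈ homPart 𝒜 lev deg (L + 1) p, d y = x)
    (hzero : ∀ j, lev j = 0 → ∃ y ∈ homPart 𝒜 lev deg 1 (deg j + m), d y = Finsupp.single j f) :
    ∃ C : ℕ → (J →₀ A) →ₗ[Aᵐᵒᵖ] (J →₀ A), C 0 = d ∧
      (∀ n : ℕ, IsHomogeneousMap 𝒜 lev deg (2 * n - 1) (n * m) (C n)) ∧
      ∀ n, ∑ p ∈ Finset.HasAntidiagonal.antidiagonal n, C p.1 ∘ₗ twist hr hn p.1 (C p.2) =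
        if n = 1 then leftMul J f else 0 := by
  suffices h : ∃ C : ℕ → (J →₀ A) →ₗ[Aᵐᵒᵖ] (J →₀ A), ∀ n : ℕ, C 0 = d ∧
      IsHomogeneousMap 𝒜 lev deg (2 * n - 1) (n * m) (C n) ∧
      ∑ p ∈ Finset.HasAntidiagonal.antidiagonal n, C p.1 ∘ₗ twist hr hn p.1 (C p.2) =
        if n = 1 then leftMul J f else 0 by
    obtain ⟨C, hC⟩ := h
    exact ⟨C, (hC 0).1, fun n => (hC n).2.1, fun n => (hC n).2.2⟩
  refine exists_sequence_of_extension _ (fun n g g' hg h => ?_) fun n g hg => ?_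
  · refine ⟨by rw [← hg 0 (by omega)]; exact h.1, by rw [← hg n le_rfl]; exact h.2.1, ?_⟩
    rw [← h.2.2]
    refine Finset.sum_congr rfl fun p hp => ?_
    rw [Finset.HasAntidiagonal.mem_antidiagonal] at hp
    rw [hg _ (by omega), hg _ (by omega)]
  rcases Nat.eq_zero_or_pos n with rfl | hn1
  · refine ⟨d, by simp, ?_, ?_⟩
    · simpa using hd
    · simp [twist_zero, hdd]
  have hg0 : g 0 = d := (hg 0 hn1).1
  have hg0u : ∀ x, Function.update g n x 0 = d := fun x => by
    rw [Function.update_of_ne (by omega), hg0]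
  -- With the unknown n-th map provisionally `0`, `S` collects the terms already determined. The
  -- missing ones, `d C_n + C_n (τ^n d)`, have to equal `O`.
  set g₀ := Function.update g n 0 with hg₀
  have hg₀n : g₀ n = 0 := by simp [hg₀]
  have hg₀i : ∀ i, i ≠ n → g₀ i = g i := fun i hi => by rw [hg₀, Function.update_of_ne hi]
  have hg₀0 : g₀ 0 = d := hg0u 0
  set S := ∑ p ∈ Finset.HasAntidiagonal.antidiagonal n, g₀ p.1 ∘ₗ twist hr hn p.1 (g₀ p.2) with hS
  set O := (if n = 1 then leftMul J f else 0) + -S with hO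
  let e : ℕ → AddMonoid.End (J →₀ A) := fun i => semilinear hr hn i (g₀ i)
  have he : ∀ i, ∑ p ∈ Finset.HasAntidiagonal.antidiagonal i, e p.1 * e p.2 =
      semilinear hr hn i
        (∑ p ∈ Finset.HasAntidiagonal.antidiagonal i, g₀ p.1 ∘ₗ twist hr hn p.1 (g₀ p.2)) := by
    intro i
    rw [semilinear_sum]
    refine Finset.sum_congr rfl fun p hp => ?_
    rw [Finset.HasAntidiagonal.mem_antidiagonal] at hp
    rw [semilinear_mul, hp]
  have hsl : ∀ i, semilinear hr hn i (if i = 1 then leftMul J f else 0) =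
      if i = 1 then rightMul J f else 0 := by
    intro i
    split_ifs with hi
    · rw [hi, semilinear_leftMul]
    · exact semilinear_zero hr hn i
  have hcomm := commute_obstruction e (rightMul J f) n hn1
    (fun i => semilinear_comm_rightMul hr hn i _) (fun i hi => by
      rw [he, ← hsl, ← (hg i hi).2.2]
      congr 1
      refine Finset.sum_congr rfl fun p hp => ?_
      rw [Finset.HasAntidiagonal.mem_antidiagonal] at hp
      rw [hg₀i _ (by omega), hg₀i _ (by omega)])
  -- Commutation of endomorphisms, with `τ^n` stripped off again, says that `O` is a chain map from
  -- the complex with differential `τ^n d` to the one with differential `d`.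
  have hdO : d ∘ₗ O = O ∘ₗ twist hr hn n d := by
    have h1 : semilinear hr hn n O = (if n = 1 then rightMul J f else 0) -
        ∑ p ∈ Finset.HasAntidiagonal.antidiagonal n, e p.1 * e p.2 := by
      rw [hO, semilinear_add, semilinear_neg, hsl, he]
      exact (sub_eq_add_neg _ _).symm
    have h2 : e 0 * semilinear hr hn n O = semilinear hr hn n O * e 0 := by
      rw [h1]
      exact hcomm
    change semilinear hr hn 0 (g₀ 0) * _ = _ * semilinear hr hn 0 (g₀ 0) at h2
    rw [semilinear_mul, semilinear_mul, zero_add, add_zero, twist_zero, hg₀0] at h2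
    exact semilinear_injective hr hn n h2
  have hOhom : IsHomogeneousMap 𝒜 lev deg (2 * n - 2) (n * m) O := by
    refine IsHomogeneousMap.add ?_ (IsHomogeneousMap.neg (IsHomogeneousMap.sum _ fun p hp => ?_))
    · split_ifs with h
      · subst h
        simpa using isHomogeneousMap_leftMul hfm
      · intro j
        exact zero_mem _
    · rw [Finset.HasAntidiagonal.mem_antidiagonal] at hp
      by_cases h1 : p.1 = n
      · rw [h1, hg₀n, LinearMap.zero_comp]
        exact fun j => zero_mem _
      by_cases h2 : p.2 = n
      · rw [h2, hg₀n, twist_zero_map, LinearMap.comp_zero]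
        exact fun j => zero_mem _
      rw [hg₀i _ h1, hg₀i _ h2]
      have h := (hg p.1 (by omega)).2.1.comp ((hg p.2 (by omega)).2.1.twist hfm hr hn p.1)
      have hpn : (n : ℤ) = p.1 + p.2 := by exact_mod_cast hp.symm
      convert h using 1 <;> rw [hpn] <;> ring
  have hd' := hd.twist hfm hr hn n
  obtain ⟨h, hh, hdh⟩ := exists_nullhomotopy hd'
    (by rw [← twist_comp, hdd, twist_zero_map]) hdO hOhom (by
      intro j hj
      -- On a basis vector of level 0, `O` lands in level `2n - 2`. For `n = 1` this is level 0,
      -- where exactness is not assumed; there `S = 0`, and `hzero` bounds `f e_j`. For `n ≥ 2`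
      -- exactness applies, the value being a cycle because `τ^n d` kills level 0.
      by_cases h1 : n = 1
      · subst h1
        obtain ⟨y, hy, hyd⟩ := hzero j hj
        refine ⟨y, by simpa [hj] using hy, ?_⟩
        have : S = 0 := by
          rw [hS]
          refine Finset.sum_eq_zero fun p hp => ?_
          rw [Finset.HasAntidiagonal.mem_antidiagonal] at hp
          rcases (by omega : p.1 = 1 ∨ p.2 = 1) with h | h
          · rw [h, hg₀n, LinearMap.zero_comp]
          · rw [h, hg₀n, twist_zero_map, LinearMap.comp_zero]
        rw [hyd, hO, this, if_pos rfl, LinearMap.add_apply, LinearMap.neg_apply,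
          LinearMap.zero_apply, neg_zero, add_zero, leftMul_single]
      · obtain ⟨y, hy, hyd⟩ := hexact (lev j + (2 * n - 2)) (deg j + n * m) (by omega) _
          (hOhom j) (by
          have h2 := LinearMap.congr_fun hdO (Finsupp.single j 1)
          rw [LinearMap.comp_apply] at h2
          rw [h2, LinearMap.comp_apply,
            eq_zero_of_mem_levelPart_of_neg (by omega) (hd' j).1, map_zero])
        exact ⟨y, by rwa [add_assoc] at hy, hyd⟩)
    (by
      intro j hj x hx hdx
      obtain ⟨y, hy, hyd⟩ := hexact _ _ (by omega) x hx hdx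
      exact ⟨y, by rwa [add_assoc] at hy, hyd⟩)
  refine ⟨h, hg0u h, ?_, ?_⟩
  · rw [Function.update_self]
    convert hh using 1
    ring
  -- Only the two extreme terms involve the n-th map; they supply the homotopy expression for `O`.
  · have key : ∀ p ∈ Finset.HasAntidiagonal.antidiagonal n,
        Function.update g n h p.1 ∘ₗ twist hr hn p.1 (Function.update g n h p.2) =
        g₀ p.1 ∘ₗ twist hr hn p.1 (g₀ p.2) + (if p.1 = 0 then d ∘ₗ h else 0) +
          (if p.2 = 0 then h ∘ₗ twist hr hn n d else 0) := by
      rintro ⟨i, j⟩ hp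
      rw [Finset.HasAntidiagonal.mem_antidiagonal] at hp
      dsimp only at hp ⊢
      by_cases hi : i = 0
      · subst hi
        obtain rfl : j = n := by omega
        rw [hg0u, Function.update_self, hg₀n, twist_zero_map, twist_zero, if_pos rfl,
          if_neg (by omega), LinearMap.comp_zero, zero_add, add_zero]
      by_cases hj : j = 0
      · subst hj
        obtain rfl : i = n := by omega
        rw [hg0u, Function.update_self, hg₀n, if_pos rfl, if_neg (by omega), LinearMap.zero_comp,
          zero_add, zero_add]
      · rw [Function.update_of_ne (by omega), Function.update_of_ne (by omega), hg₀i _ (by omega),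
          hg₀i _ (by omega), if_neg hi, if_neg hj, add_zero, add_zero]
    rw [Finset.sum_congr rfl key, Finset.sum_add_distrib, Finset.sum_add_distrib,
      sum_antidiagonal_ite_fst, sum_antidiagonal_ite_snd, add_assoc, hdh, ← hS, hO]
    abel

end HigherHomotopies

/-! ### The operator `D = ∑ E_n S^n` and its cycles modulo `ρ` -/

section TotalDifferential

variable {M : Type*} [AddCommGroup M]

/-- The operator `∑_{n < N} E_n S^n` on sequences, where `S` is the shift. -/
def totalDiff (E : ℕ → M →+ M) (N : ℕ) (x : ℕ → M) (t : ℕ) : M :=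
  ∑ n ∈ Finset.range N, E n (x (t + n))

variable {E : ℕ → M →+ M} {N : ℕ}

theorem totalDiff_add (x y : ℕ → M) (t : ℕ) :
    totalDiff E N (fun s => x s + y s) t = totalDiff E N x t + totalDiff E N y t := by
  simp [totalDiff, Finset.sum_add_distrib]

theorem totalDiff_sub (x y : ℕ → M) (t : ℕ) :
    totalDiff E N (fun s => x s - y s) t = totalDiff E N x t - totalDiff E N y t := by
  simp [totalDiff, Finset.sum_sub_distrib]

theorem totalDiff_of_pos_eq_zero (hN : 1 ≤ N) {x : ℕ → M} (hx : ∀ s, 1 ≤ s → x s = 0) (t : ℕ) :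
    totalDiff E N x t = E 0 (x t) := by
  rw [totalDiff, Finset.sum_eq_single_of_mem 0 (by rw [Finset.mem_range]; omega)]
  · rfl
  · intro n _ hn
    rw [hx _ (by omega), map_zero]

/-- Regrouping by total shift, the coefficient of `S^n` in `D²` is `∑_{i+j=n} E_i E_j`, so `D² = ρ
S`. Truncation at `N` loses nothing since `x` vanishes from `N` on. -/
theorem totalDiff_totalDiff {ρ : M →+ M}
    (hE : ∀ n x, ∑ p ∈ Finset.HasAntidiagonal.antidiagonal n, E p.1 (E p.2 x) =
      if n = 1 then ρ x else 0) (hN : 2 ≤ N) {x : ℕ → M} (hx : ∀ s, N ≤ s → x s = 0) (t : ℕ) :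
    totalDiff E N (totalDiff E N x) t = ρ (x (t + 1)) := by
  have h1 : totalDiff E N (totalDiff E N x) t =
      ∑ n ∈ Finset.range N, ∑ l ∈ Finset.range (N - n), E n (E l (x (t + (n + l)))) := by
    refine Finset.sum_congr rfl fun n _ => ?_
    rw [totalDiff, map_sum]
    symm
    simp only [add_assoc]
    refine Finset.sum_subset (Finset.range_mono (by omega)) fun l _ hl => ?_
    rw [Finset.mem_range, not_lt] at hl
    rw [hx _ (by omega), map_zero, map_zero]
  rw [h1, ← Finset.sum_range_diag_flip N fun n l => E n (E l (x (t + (n + l))))]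
  have h2 : ∀ p ∈ Finset.range N,
      ∑ n ∈ Finset.range (p + 1), E n (E (p - n) (x (t + (n + (p - n))))) =
      if p = 1 then ρ (x (t + 1)) else 0 := by
    intro p _
    have := hE p (x (t + p))
    rw [Finset.Nat.sum_antidiagonal_eq_sum_range_succ (fun i j => E i (E j (x (t + p))))] at this
    trans ∑ n ∈ Finset.range (p + 1), E n (E (p - n) (x (t + p)))
    · refine Finset.sum_congr rfl fun n hn => ?_
      rw [Finset.mem_range] at hn
      rw [Nat.add_sub_of_le (by omega)]
    · rw [this]
      split_ifs with h
      · rw [h]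
      · rfl
  rw [Finset.sum_congr rfl h2, Finset.sum_ite_eq' (Finset.range N) 1,
    if_pos (by rw [Finset.mem_range]; omega)]

theorem totalDiff_mem {lv : ℤ → AddSubgroup M}
    (hlv : ∀ (n : ℕ) L, ∀ x ∈ lv L, E n x ∈ lv (L + (2 * n - 1))) {i : ℤ} {x : ℕ → M}
    (hx : ∀ s : ℕ, x s ∈ lv (i + 1 - 2 * s)) (t : ℕ) : totalDiff E N x t ∈ lv (i - 2 * t) := by
  refine sum_mem fun n _ => ?_
  have h := hlv n _ _ (hx (t + n))
  convert h using 2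
  push_cast
  ring

/-- If `∑ E_i E_j = δ_{n,1} ρ` and `E_0` is exact in positive levels, then every cycle of
`∑ E_n S^n` modulo `ρ` is a boundary. -/
theorem exists_totalDiff_eq {ρ : M →+ M} {lv : ℤ → AddSubgroup M}
    (hE : ∀ n x, ∑ p ∈ Finset.HasAntidiagonal.antidiagonal n, E p.1 (E p.2 x) =
      if n = 1 then ρ x else 0)
    (hρ : Function.Injective ρ) (hρE : ∀ n x, E n (ρ x) = ρ (E n x))
    (hneg : ∀ L < 0, ∀ x ∈ lv L, x = 0)
    (hlv : ∀ (n : ℕ) L, ∀ x ∈ lv L, E n x ∈ lv (L + (2 * n - 1)))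
    (hexact : ∀ L, 1 ≤ L → ∀ x ∈ lv L, E 0 x = 0 → ∃ y ∈ lv (L + 1), E 0 y = x)
    {i : ℕ} (hN : i + 4 ≤ N) {x y : ℕ → M} (hx : ∀ s : ℕ, x s ∈ lv (i + 1 - 2 * s))
    (hy : ∀ s : ℕ, y s ∈ lv (i - 2 * s)) (hxy : ∀ t, totalDiff E N x t = ρ (y t)) :
    ∃ z : ℕ → M, (∀ s : ℕ, z s ∈ lv (i + 2 - 2 * s)) ∧ ∀ t, totalDiff E N z t = x t := by
  have hx0 : ∀ s, N ≤ s → x s = 0 := fun s hs => hneg _ (by omega) _ (hx s)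
  -- `ρ D y = D ρ y = D D x = ρ S x`; cancel the injective `ρ`.
  have hDy : ∀ t, totalDiff E N y t = x (t + 1) := by
    intro t
    apply hρ
    rw [← totalDiff_totalDiff hE (by omega) hx0 t, totalDiff, totalDiff, map_sum]
    exact Finset.sum_congr rfl fun n _ => by rw [hxy, hρE]
  -- Prepending `a` to `y` makes `S z = y`, so `D z` already equals `x` in all positive positions,
  -- whatever `a` is.
  let z : M → ℕ → M := fun a s => s.casesOn a y
  have hz : ∀ a ∈ lv (i + 2), ∀ s : ℕ, z a s ∈ lv (i + 2 - 2 * s) := by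
    rintro a ha (_ | s)
    · simpa [z] using ha
    · convert hy s using 2
      push_cast
      ring
  have hDz : ∀ a t, totalDiff E N (z a) (t + 1) = x (t + 1) := by
    intro a t
    rw [← hDy]
    refine Finset.sum_congr rfl fun n _ => ?_
    rw [add_right_comm]
  have hz0 := hz 0 (zero_mem _)
  -- For `z` with `a = 0`, the error `x - D z` lives in position 0. Applying `D` there gives `ρ y_0
  -- - ρ (S z)_0 = 0`, so the error is an `E_0`-cycle of level `i + 1 ≥ 1` and bounds the required
  -- `a`.
  obtain ⟨a, ha, hax⟩ := hexact (i + 1) (by omega) (x 0 - totalDiff E N (z 0) 0)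
    (sub_mem (by simpa using hx 0) (by
      simpa using totalDiff_mem (N := N) hlv (i := i + 1) (x := z 0) (by
        intro s
        convert hz0 s using 2
        ring) 0)) (by
      rw [← totalDiff_of_pos_eq_zero (E := E) (N := N) (by omega)
        (x := fun t => x t - totalDiff E N (z 0) t) (t := 0)]
      · rw [totalDiff_sub, hxy, totalDiff_totalDiff hE (by omega)
          (fun s hs => hneg _ (by omega) _ (hz0 s))]
        exact sub_self _
      · rintro (_ | s) hs
        · omega
        · rw [hDz, sub_self])
  refine ⟨z a, hz a (by rwa [add_assoc] at ha), ?_⟩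
  rintro (_ | t)
  · have e : z a = fun s => z 0 s + if s = 0 then a else 0 := by
      funext s
      cases s <;> simp [z]
    rw [e, totalDiff_add, totalDiff_of_pos_eq_zero (by omega) (x := fun s => if s = 0 then a else 0)
      (fun s hs => if_neg (by omega)), if_pos rfl, hax, add_sub_cancel]
  · exact hDz a t

end TotalDifferential

/-! ### The total module of a family of free modules, and its blocks -/

section TotalModule

variable {A : Type*} [Ring A] {ι : ℕ → Type*}

/-- The inclusion of the summand of level `l` of a free module on `Σ l, ι l`. -/
noncomputable def incl (A : Type*) [Ring A] {ι : ℕ → Type*} (l : ℕ) :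
    (ι l →₀ A) →ₗ[Aᵐᵒᵖ] ((Σ l, ι l) →₀ A) :=
  Finsupp.lmapDomain A Aᵐᵒᵖ (Sigma.mk l)

/-- The projection to the summand of level `l` of a free module on `Σ l, ι l`. -/
noncomputable def proj (A : Type*) [Ring A] {ι : ℕ → Type*} (l : ℕ) :
    ((Σ l, ι l) →₀ A) →ₗ[Aᵐᵒᵖ] (ι l →₀ A) :=
  Finsupp.lcomapDomain (Sigma.mk l) sigma_mk_injective

@[simp]
theorem proj_apply (l : ℕ) (x : (Σ l, ι l) →₀ A) (b : ι l) : proj A l x b = x ⟨l, b⟩ := rfl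

@[simp]
theorem incl_apply (l : ℕ) (x : ι l →₀ A) (b : ι l) : incl A l x ⟨l, b⟩ = x b :=
  Finsupp.mapDomain_apply sigma_mk_injective x b

@[simp]
theorem incl_single (l : ℕ) (b : ι l) (a : A) :
    incl A l (Finsupp.single b a) = Finsupp.single ⟨l, b⟩ a :=
  Finsupp.mapDomain_single

theorem proj_incl (l : ℕ) (x : ι l →₀ A) : proj A l (incl A l x) = x := by
  ext b
  simp

theorem incl_injective (l : ℕ) : Function.Injective (incl A (ι := ι) l) :=
  Function.LeftInverse.injective (proj_incl l)

theorem incl_mem_levelPart (l : ℕ) (x : ι l →₀ A) :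
    incl A l x ∈ levelPart A (Sigma.fst : (Σ l, ι l) → ℕ) l := by
  rintro ⟨l', b⟩ h
  refine Finsupp.mapDomain_of_notMem_range _ _ ?_
  rintro ⟨b', hb'⟩
  exact h (by rw [← hb'])

theorem incl_proj {l : ℕ} {x : (Σ l, ι l) →₀ A} (hx : x ∈ levelPart A Sigma.fst l) :
    incl A l (proj A l x) = x := by
  ext ⟨l', b⟩
  by_cases h : l' = l
  · subst h
    simp
  · rw [hx ⟨l', b⟩ (by simpa using h), incl_mem_levelPart l _ ⟨l', b⟩ (by simpa using h)]

theorem proj_eq_zero {l : ℕ} {L : ℤ} (hL : L ≠ l) {x : (Σ l, ι l) →₀ A}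
    (hx : x ∈ levelPart A Sigma.fst L) : proj A l x = 0 := by
  ext b
  exact hx ⟨l, b⟩ hL.symm

theorem mapCoeff_incl (g : A →+* A) (l : ℕ) (x : ι l →₀ A) :
    mapCoeff g (incl A l x) = incl A l (mapCoeff g x) :=
  mapCoeff_mapDomain g _ x

/-- The endomorphism of the total module with blocks `φ l (l + 2 n - 1)`. -/
noncomputable def totalMap (n : ℕ) (φ : ∀ l l', (ι l →₀ A) →ₗ[Aᵐᵒᵖ] (ι l' →₀ A)) :
    ((Σ l, ι l) →₀ A) →ₗ[Aᵐᵒᵖ] ((Σ l, ι l) →₀ A) :=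
  ofColumns fun j => incl A (j.1 + 2 * n - 1) (φ j.1 (j.1 + 2 * n - 1) (Finsupp.single j.2 1))

variable {n : ℕ} {φ : ∀ l l', (ι l →₀ A) →ₗ[Aᵐᵒᵖ] (ι l' →₀ A)}

theorem totalMap_incl {l l' : ℕ} (h : l + 2 * n - 1 = l') (x : ι l →₀ A) :
    totalMap n φ (incl A l x) = incl A l' (φ l l' x) := by
  subst h
  have : totalMap n φ ∘ₗ incl A l = incl A _ ∘ₗ φ l (l + 2 * n - 1) := by
    refine linearMap_ext fun b => ?_
    rw [LinearMap.comp_apply, incl_single, totalMap, ofColumns_single, op_one, one_smul]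
    rfl
  exact LinearMap.congr_fun this x

/-- For `l = n = 0` truncated subtraction makes the target index `0` instead of `-1`; the shape
condition annihilates that spurious block. -/
theorem totalMap_incl_zero (hφ : ∀ l l', l' + 1 ≠ l + 2 * n → φ l l' = 0) {l : ℕ}
    (h : l + 2 * n = 0) (x : ι l →₀ A) : totalMap n φ (incl A l x) = 0 := by
  rw [totalMap_incl rfl, hφ _ _ (by omega), LinearMap.zero_apply, map_zero]

theorem totalMap_mem_levelPart (hφ : ∀ l l', l' + 1 ≠ l + 2 * n → φ l l' = 0)
    (j : Σ l, ι l) :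
    totalMap n φ (Finsupp.single j 1) ∈ levelPart A Sigma.fst ((j.1 : ℤ) + (2 * n - 1)) := by
  obtain ⟨l, b⟩ := j
  rw [← incl_single]
  by_cases h : l + 2 * n = 0
  · rw [totalMap_incl_zero hφ h]
    exact zero_mem _
  · rw [totalMap_incl rfl]
    convert incl_mem_levelPart (A := A) (ι := ι) (l + 2 * n - 1) _ using 2
    dsimp only
    omega

variable {f : A} (hr : IsRegularElt f) (hn : IsNormalElt f)

theorem totalMap_twist_totalMap_incl {i j : ℕ} {ψ : ∀ l l', (ι l →₀ A) →ₗ[Aᵐᵒᵖ] (ι l' →₀ A)}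
    {l l' l'' : ℕ} (h : l + 2 * j - 1 = l') (h' : l' + 2 * i - 1 = l'') (b : ι l) :
    (totalMap i φ ∘ₗ twist hr hn i (totalMap j ψ)) (Finsupp.single ⟨l, b⟩ 1) =
      incl A l'' ((φ l' l'' ∘ₗ twist hr hn i (ψ l l')) (Finsupp.single b 1)) := by
  rw [LinearMap.comp_apply, twist_single, ← incl_single, totalMap_incl h, mapCoeff_incl,
    ← twist_single, totalMap_incl h']
  rfl

/-- The dictionary between the convolution identity on the total module and the blockwise equations:
the two ends of the antidiagonal are the differential terms, and the interior is the sum over `0 < i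
< n`. -/
theorem sum_totalMap_comp_single (c : ℕ → ∀ l l', (ι l →₀ A) →ₗ[Aᵐᵒᵖ] (ι l' →₀ A))
    (hc : ∀ n l l', l' + 1 ≠ l + 2 * n → c n l l' = 0) (hn1 : 1 ≤ n) (l : ℕ) (b : ι l) :
    (∑ p ∈ Finset.HasAntidiagonal.antidiagonal n,
        totalMap p.1 (c p.1) ∘ₗ twist hr hn p.1 (totalMap p.2 (c p.2)))
          (Finsupp.single ⟨l, b⟩ 1) =
      incl A (l + 2 * n - 2) ((∑ i ∈ Finset.Ioo 0 n,
        c i (l + 2 * (n - i) - 1) (l + 2 * n - 2) ∘ₗ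
          twist hr hn i (c (n - i) l (l + 2 * (n - i) - 1)) +
        (c n (l - 1) (l + 2 * n - 2) ∘ₗ twist hr hn n (c 0 l (l - 1)) +
          c 0 (l + 2 * n - 1) (l + 2 * n - 2) ∘ₗ c n l (l + 2 * n - 1)))
          (Finsupp.single b 1)) := by
  rw [Finset.Nat.sum_antidiagonal_eq_sum_range_succ
    (fun i j => totalMap i (c i) ∘ₗ twist hr hn i (totalMap j (c j))), Finset.sum_range_succ,
    Finset.range_eq_Ico, ← Finset.add_sum_Ioo_eq_sum_Ico (by omega), LinearMap.add_apply,
    LinearMap.add_apply, LinearMap.sum_apply, LinearMap.add_apply, LinearMap.sum_apply, map_add,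
    map_sum, LinearMap.add_apply, map_add]
  have h1 : (totalMap 0 (c 0) ∘ₗ twist hr hn 0 (totalMap (n - 0) (c (n - 0))))
      (Finsupp.single ⟨l, b⟩ 1) = incl A (l + 2 * n - 2)
        ((c 0 (l + 2 * n - 1) (l + 2 * n - 2) ∘ₗ c n l (l + 2 * n - 1)) (Finsupp.single b 1)) := by
    rw [Nat.sub_zero, totalMap_twist_totalMap_incl hr hn (l' := l + 2 * n - 1)
      (l'' := l + 2 * n - 2) rfl (by omega), twist_zero]
  have h2 : (totalMap n (c n) ∘ₗ twist hr hn n (totalMap (n - n) (c (n - n))))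
      (Finsupp.single ⟨l, b⟩ 1) = incl A (l + 2 * n - 2)
        ((c n (l - 1) (l + 2 * n - 2) ∘ₗ twist hr hn n (c 0 l (l - 1))) (Finsupp.single b 1)) := by
    rw [Nat.sub_self]
    -- At `l = 0` the truncated index `l - 1` is `0`, but `c 0 0 0 = 0`, so both sides vanish.
    rcases Nat.eq_zero_or_pos l with rfl | hl
    · rw [totalMap_twist_totalMap_incl hr hn rfl rfl, hc 0 _ _ (by omega),
        twist_zero_map]
      simp
    · rw [totalMap_twist_totalMap_incl hr hn (l' := l - 1) (l'' := l + 2 * n - 2) (by omega)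
        (by omega)]
  have h3 : ∀ i ∈ Finset.Ioo 0 n,
      (totalMap i (c i) ∘ₗ twist hr hn i (totalMap (n - i) (c (n - i))))
        (Finsupp.single ⟨l, b⟩ 1) = incl A (l + 2 * n - 2)
        ((c i (l + 2 * (n - i) - 1) (l + 2 * n - 2) ∘ₗ
          twist hr hn i (c (n - i) l (l + 2 * (n - i) - 1))) (Finsupp.single b 1)) := by
    intro i hi
    rw [Finset.mem_Ioo] at hi
    rw [totalMap_twist_totalMap_incl hr hn (l' := l + 2 * (n - i) - 1) (l'' := l + 2 * n - 2)
      (by omega) (by omega)]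
  rw [h1, h2, Finset.sum_congr rfl h3]
  abel

end TotalModule

/-! ### The total complex of a resolution; existence of homotopy systems -/

section TotalComplex

variable {k : Type*} [Field k] {A : Type*} [Ring A] [Algebra k A] {𝒜 : ℤ → Submodule k A}
  {P : AugmentedSequence 𝒜}

/-- The degrees of the basis of the total module. -/
def AugmentedSequence.totalDeg (P : AugmentedSequence 𝒜) (j : Σ l, P.ι l) : ℤ := P.deg j.1 j.2

theorem AugmentedSequence.IsFreeResolution.shape' (hP : P.IsFreeResolution) (l l' : ℕ)
    (h : l' + 1 ≠ l + 2 * 0) : P.d l l' = 0 :=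
  hP.shape l l' (by omega)

theorem AugmentedSequence.IsFreeResolution.exists_totalMap_eq (hP : P.IsFreeResolution) {L : ℤ}
    (hL : 1 ≤ L) {x : (Σ l, P.ι l) →₀ A} (hx : x ∈ levelPart A Sigma.fst L)
    (hdx : totalMap 0 P.d x = 0) :
    ∃ l : ℕ, L = l + 1 ∧ ∃ y : P.ι (l + 2) →₀ A, P.d (l + 2) (l + 1) y = proj A (l + 1) x := by
  obtain ⟨l, rfl⟩ : ∃ l : ℕ, L = l + 1 := ⟨(L - 1).toNat, by omega⟩
  refine ⟨l, rfl, (hP.exact l _).mp (incl_injective l ?_)⟩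
  rw [← totalMap_incl (n := 0) (φ := P.d) (by omega), incl_proj (by exact_mod_cast hx), hdx,
    map_zero]

/-- The form of exactness without degrees, used for `T`, whose elements are lifted to `A` without
homogeneity. -/
theorem AugmentedSequence.IsFreeResolution.exists_mem_levelPart (hP : P.IsFreeResolution) {L : ℤ}
    (hL : 1 ≤ L) {x : (Σ l, P.ι l) →₀ A} (hx : x ∈ levelPart A Sigma.fst L)
    (hdx : totalMap 0 P.d x = 0) :
    ∃ y ∈ levelPart A Sigma.fst (L + 1), totalMap 0 P.d y = x := by
  obtain ⟨l, rfl, y, hy⟩ := hP.exists_totalMap_eq hL hx hdx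
  refine ⟨incl A (l + 2) y, by exact_mod_cast incl_mem_levelPart (l + 2) y, ?_⟩
  rw [totalMap_incl (l' := l + 1) (by omega), hy, incl_proj (by exact_mod_cast hx)]

theorem incl_mem_homPart {l : ℕ} {p : ℤ} {y : P.ι l →₀ A} (hy : ∀ b, y b ∈ 𝒜 (p - P.deg l b)) :
    incl A l y ∈ homPart 𝒜 Sigma.fst P.totalDeg l p := by
  refine ⟨incl_mem_levelPart l y, ?_⟩
  rintro ⟨l', b⟩
  by_cases h : l' = l
  · subst h
    rw [incl_apply]
    exact hy b
  · rw [incl_mem_levelPart l y ⟨l', b⟩ (by simpa using h)]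
    exact zero_mem _

variable [GradedAlgebra 𝒜]

theorem AugmentedSequence.IsFreeResolution.exists_mem_homPart (hP : P.IsFreeResolution) {L p : ℤ}
    (hL : 1 ≤ L) {x : (Σ l, P.ι l) →₀ A} (hx : x ∈ homPart 𝒜 Sigma.fst P.totalDeg L p)
    (hdx : totalMap 0 P.d x = 0) :
    ∃ y ∈ homPart 𝒜 Sigma.fst P.totalDeg (L + 1) p, totalMap 0 P.d y = x := by
  obtain ⟨l, rfl, y, hy⟩ := hP.exists_totalMap_eq hL hx.1 hdx
  obtain ⟨z, hz, hzp⟩ := exists_homogeneous_preimage (P.deg (l + 2)) (P.deg (l + 1)) _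
    (hP.d_degree _ _) hy (p := p) fun b => hx.2 ⟨l + 1, b⟩
  refine ⟨incl A (l + 2) z, by exact_mod_cast incl_mem_homPart hzp, ?_⟩
  rw [totalMap_incl (l' := l + 1) (by omega), hz, incl_proj (by exact_mod_cast hx.1)]

omit [GradedAlgebra 𝒜] in
theorem AugmentedSequence.IsFreeResolution.isHomogeneousMap_totalMap (hP : P.IsFreeResolution) :
    IsHomogeneousMap 𝒜 Sigma.fst P.totalDeg (-1) 0 (totalMap 0 P.d) := by
  intro j
  refine ⟨by simpa using totalMap_mem_levelPart hP.shape' j, ?_⟩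
  obtain ⟨l, b⟩ := j
  rw [← incl_single, totalMap_incl rfl]
  refine (incl_mem_homPart fun a => ?_).2
  rw [add_zero]
  exact hP.d_degree _ _ _ _

omit [GradedAlgebra 𝒜] in
theorem AugmentedSequence.IsFreeResolution.totalMap_comp_totalMap (hP : P.IsFreeResolution) :
    totalMap 0 P.d ∘ₗ totalMap 0 P.d = 0 := by
  refine linearMap_ext fun ⟨l, b⟩ => ?_
  rw [LinearMap.comp_apply, ← incl_single, totalMap_incl rfl, totalMap_incl rfl]
  rcases l with _ | _ | l
  · rw [hP.shape 0 (0 + 2 * 0 - 1) (by omega)]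
    simp
  · rw [hP.shape (0 + 1 + 2 * 0 - 1) (0 + 1 + 2 * 0 - 1 + 2 * 0 - 1) (by omega)]
    simp
  · exact (congrArg _ ((hP.exact l).apply_apply_eq_zero _)).trans (map_zero _)

/-- `ε(e_b f) = ε(e_b) f = 0` because `f` lies in the two-sided ideal `A_{≥1}`. Exactness at `P_0`
gives a preimage, which is then made homogeneous. -/
theorem AugmentedSequence.IsFreeResolution.exists_totalMap_eq_single (hP : P.IsFreeResolution)
    (hA : IsConnectedGraded 𝒜) {m : ℤ} (hm : 1 ≤ m) {f : A} (hfm : f ∈ 𝒜 m) (j : Σ l, P.ι l)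
    (hj : j.1 = 0) : ∃ y ∈ homPart 𝒜 Sigma.fst P.totalDeg 1 (P.totalDeg j + m),
      totalMap 0 P.d y = Finsupp.single j f := by
  obtain ⟨l, b⟩ := j
  obtain rfl : l = 0 := hj
  classical
  have h : P.ε (Finsupp.single b f) = 0 := by
    rw [single_eq_smul_one, map_smul]
    obtain ⟨a, ha⟩ := (augIdeal 𝒜).mkQ_surjective (P.ε (Finsupp.single b 1))
    rw [← ha, ← map_smul, Submodule.mkQ_apply, Submodule.Quotient.mk_eq_zero]
    exact mul_mem_augIdeal hA a (mem_augIdeal_of_mem hm hfm)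
  obtain ⟨y, hy⟩ := (hP.exact_zero _).mp h
  obtain ⟨z, hz, hzp⟩ := exists_homogeneous_preimage (P.deg 1) (P.deg 0) _
    (hP.d_degree _ _) hy (p := P.deg 0 b + m) (by
      intro a
      by_cases h : b = a
      · subst h
        rw [Finsupp.single_eq_same, add_sub_cancel_left]
        exact hfm
      · rw [Finsupp.single_eq_of_ne' h]
        exact zero_mem _)
  refine ⟨incl A 1 z, by exact_mod_cast incl_mem_homPart hzp, ?_⟩
  rw [totalMap_incl (l' := 0) (by omega), hz, incl_single]

theorem AugmentedSequence.IsFreeResolution.exists_isHomotopySystem (hP : P.IsFreeResolution)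
    (hA : IsConnectedGraded 𝒜) {m : ℤ} (hm : 1 ≤ m) {f : A} (hfm : f ∈ 𝒜 m)
    (hr : IsRegularElt f) (hn : IsNormalElt f) : ∃ c, IsHomotopySystem P hr hn m c := by
  obtain ⟨C, hC0, hC, hCC⟩ := exists_higher_homotopies hfm hr hn hP.isHomogeneousMap_totalMap
    hP.totalMap_comp_totalMap (fun L p hL x hx hdx => hP.exists_mem_homPart hL hx hdx)
    (fun j hj => hP.exists_totalMap_eq_single hA hm hfm j hj)
  -- The system consists of the blocks of the total solution. By level homogeneity the only possibly
  -- nonzero blocks are those from `l` to `l + 2n - 1`, so nothing is lost.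
  let c : ℕ → ∀ l l', (P.ι l →₀ A) →ₗ[Aᵐᵒᵖ] (P.ι l' →₀ A) :=
    fun n l l' => proj A l' ∘ₗ C n ∘ₗ incl A l
  have hc_single : ∀ n l l' (b : P.ι l), c n l l' (Finsupp.single b 1) =
      proj A l' (C n (Finsupp.single ⟨l, b⟩ 1)) := fun n l l' b => by
    rw [← incl_single]
    rfl
  have hshape : ∀ n l l', l' + 1 ≠ l + 2 * n → c n l l' = 0 := by
    intro n l l' h
    refine linearMap_ext fun b => ?_
    rw [hc_single]
    refine proj_eq_zero ?_ (hC n ⟨l, b⟩).1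
    dsimp only
    omega
  have htotal : ∀ n, totalMap n (c n) = C n := by
    intro n
    refine linearMap_ext fun ⟨l, b⟩ => ?_
    have h1 := (hC n ⟨l, b⟩).1
    by_cases h : l + 2 * n = 0
    · rw [← incl_single, totalMap_incl_zero (hshape n) h, incl_single,
        eq_zero_of_mem_levelPart_of_neg (by dsimp only; omega) h1]
    · rw [← incl_single, totalMap_incl rfl, hc_single, incl_single]
      refine incl_proj ?_
      convert h1 using 2
      dsimp only
      omega
  have hzero : c 0 = P.d := by
    funext l l'
    by_cases h : l' + 1 = l
    · refine linearMap_ext fun b => ?_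
      rw [hc_single, hC0, ← incl_single, totalMap_incl (l' := l') (by omega), proj_incl]
    · rw [hshape 0 l l' (by omega), hP.shape l l' h]
  have hrel : ∀ n, 1 ≤ n → ∀ l, ∑ i ∈ Finset.Ioo 0 n,
        c i (l + 2 * (n - i) - 1) (l + 2 * n - 2) ∘ₗ
          twist hr hn i (c (n - i) l (l + 2 * (n - i) - 1)) +
        (c n (l - 1) (l + 2 * n - 2) ∘ₗ twist hr hn n (P.d l (l - 1)) +
          P.d (l + 2 * n - 1) (l + 2 * n - 2) ∘ₗ c n l (l + 2 * n - 1)) =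
      proj A (l + 2 * n - 2) ∘ₗ (if n = 1 then leftMul _ f else 0) ∘ₗ incl A l := by
    intro n hn1 l
    refine linearMap_ext fun b => ?_
    have h := sum_totalMap_comp_single hr hn c hshape hn1 l b
    simp only [htotal, hCC] at h
    rw [LinearMap.comp_apply, LinearMap.comp_apply, incl_single, h, proj_incl, hzero]
  refine ⟨c, hzero, hshape, ?_, ?_, ?_⟩
  · intro n l l' b a
    rw [hc_single, proj_apply]
    exact (hC n ⟨l, b⟩).2 ⟨l', a⟩
  · intro l
    have h := hrel 1 le_rfl l
    rw [if_pos rfl] at h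
    have e : proj A (l + 2 * 1 - 2) ∘ₗ leftMul (Σ l, P.ι l) f ∘ₗ incl A l = leftMul (P.ι l) f := by
      refine linearMap_ext fun b => ?_
      rw [LinearMap.comp_apply, LinearMap.comp_apply, incl_single, leftMul_single, leftMul_single,
        ← incl_single]
      exact proj_incl l _
    refine e.symm.trans (h.symm.trans ?_)
    rw [show Finset.Ioo 0 1 = ∅ from rfl, Finset.sum_empty, zero_add]
    rfl
  · intro n hn2 l
    have h := hrel n (by omega) l
    rw [if_neg (by omega), LinearMap.zero_comp, LinearMap.comp_zero] at h
    refine LinearMap.ext fun x => ?_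
    rw [LinearMap.neg_apply]
    exact neg_eq_of_add_eq_zero_right (LinearMap.congr_fun h x)

end TotalComplex

/-! ### The kernel of `A → A/(f)` -/

section QuotientMap

variable {A : Type*} [Ring A] {f : A}

theorem quotMap_surjective (f : A) : Function.Surjective (quotMap f) :=
  RingCon.mk'_surjective _

theorem quotMap_self (f : A) : quotMap f f = 0 := by
  have h : f ∈ TwoSidedIdeal.span {f} := TwoSidedIdeal.subset_span rfl
  rw [TwoSidedIdeal.mem_iff] at h
  exact (RingCon.eq _).mpr h

/-- By normality the left ideal `A f` is already two-sided, so it contains the ideal generated by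
`f`. -/
theorem exists_eq_mul_of_quotMap_eq_zero (hn : IsNormalElt f) {a : A} (h : quotMap f a = 0) :
    ∃ b, a = b * f := by
  have h1 : a ∈ TwoSidedIdeal.span {f} := (TwoSidedIdeal.mem_iff _ _).mpr ((RingCon.eq _).mp h)
  let I : TwoSidedIdeal A := TwoSidedIdeal.mk' {a | ∃ b, a = b * f} ⟨0, by simp⟩
    (by
      rintro _ _ ⟨b, rfl⟩ ⟨c, rfl⟩
      exact ⟨b + c, by rw [add_mul]⟩)
    (by
      rintro _ ⟨b, rfl⟩
      exact ⟨-b, by rw [neg_mul]⟩)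
    (by
      rintro x _ ⟨b, rfl⟩
      exact ⟨x * b, by rw [mul_assoc]⟩)
    (by
      rintro _ y ⟨b, rfl⟩
      obtain ⟨c, hc⟩ := hn.exists_left y
      exact ⟨b * c, by rw [mul_assoc, mul_assoc, hc]⟩)
  have h2 : a ∈ I := TwoSidedIdeal.mem_span_iff.mp h1 I (by
    rintro _ rfl
    exact (TwoSidedIdeal.mem_mk' _ _ _ _ _ _ _).mpr ⟨1, by rw [one_mul]⟩)
  exact (TwoSidedIdeal.mem_mk' {a | ∃ b, a = b * f} _ _ _ _ _ a).mp h2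

theorem exists_eq_rightMul {ι : Type*} (hr : IsRegularElt f) {x : ι →₀ A}
    (h : ∀ j, ∃ a, x j = a * f) : ∃ y, x = rightMul ι f y := by
  choose a ha using h
  refine ⟨Finsupp.onFinset x.support a fun j hj => ?_, ?_⟩
  · rw [Finsupp.mem_support_iff, ha]
    exact fun h => hj (hr _ (Or.inl h))
  · ext j
    exact ha j

end QuotientMap

/-! ### Evaluation of block matrices -/

section Blocks

variable {A : Type*} [Ring A] {S T : Type*} [Fintype T] {ι : S → Type*}
  {κ : T → Type*}

theorem blockMatrix_mapDomain (M : ∀ s t, (ι s →₀ A) →ₗ[Aᵐᵒᵖ] (κ t →₀ A)) (s : S)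
    (v : ι s →₀ A) :
    blockMatrix M (v.mapDomain (Sigma.mk s)) = ∑ t, (M s t v).mapDomain (Sigma.mk t) := by
  have h : blockMatrix M ∘ₗ Finsupp.lmapDomain A Aᵐᵒᵖ (Sigma.mk s) =
      ∑ t, Finsupp.lmapDomain A Aᵐᵒᵖ (Sigma.mk t) ∘ₗ M s t := by
    refine linearMap_ext fun b => ?_
    rw [LinearMap.comp_apply, Finsupp.lmapDomain_apply, Finsupp.mapDomain_single, blockMatrix,
      ofColumns_single, op_one, one_smul, LinearMap.sum_apply]
    rfl
  have := LinearMap.congr_fun h v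
  rwa [LinearMap.sum_apply] at this

theorem blockMatrix_sum_mapDomain [Fintype S] (M : ∀ s t, (ι s →₀ A) →ₗ[Aᵐᵒᵖ] (κ t →₀ A))
    (v : ∀ s, ι s →₀ A) :
    blockMatrix M (∑ s, (v s).mapDomain (Sigma.mk s)) =
      ∑ t, (∑ s, M s t (v s)).mapDomain (Sigma.mk t) := by
  simp only [map_sum, blockMatrix_mapDomain]
  rw [Finset.sum_comm]
  refine Finset.sum_congr rfl fun t _ => ?_
  exact (map_sum (Finsupp.lmapDomain A ℕ (Sigma.mk t)) _ _).symm

theorem sum_mapDomain_apply [Fintype S] (v : ∀ s, ι s →₀ A) (s : S) (b : ι s) :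
    (∑ s, (v s).mapDomain (Sigma.mk s)) ⟨s, b⟩ = v s b := by
  rw [Finsupp.finsetSum_apply, Finset.sum_eq_single_of_mem s (Finset.mem_univ s)]
  · exact Finsupp.mapDomain_apply sigma_mk_injective _ _
  · rintro s' _ hs'
    refine Finsupp.mapDomain_of_notMem_range _ _ ?_
    rintro ⟨b', hb'⟩
    exact hs' (congrArg Sigma.fst hb')

end Blocks

/-! ### Exactness of `T` in positive degrees -/

section QuotientSequence

variable {k : Type*} [Field k] {A : Type*} [Ring A] [Algebra k A] {𝒜 : ℤ → Submodule k A}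
  {P : AugmentedSequence 𝒜} {f : A} {hr : IsRegularElt f} {hn : IsNormalElt f} {m : ℤ}
  {c : ℕ → ∀ l l', (P.ι l →₀ A) →ₗ[Aᵐᵒᵖ] (P.ι l' →₀ A)}

theorem IsHomotopySystem.sum_totalMap_comp (hP : P.IsFreeResolution)
    (hc : IsHomotopySystem P hr hn m c) (n : ℕ) :
    ∑ p ∈ Finset.HasAntidiagonal.antidiagonal n,
        totalMap p.1 (c p.1) ∘ₗ twist hr hn p.1 (totalMap p.2 (c p.2)) =
      if n = 1 then leftMul _ f else 0 := by
  rcases Nat.eq_zero_or_pos n with rfl | hn1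
  · rw [Finset.HasAntidiagonal.antidiagonal_zero, Finset.sum_singleton, twist_zero, hc.zero,
      hP.totalMap_comp_totalMap, if_neg (by omega)]
  refine linearMap_ext fun ⟨l, b⟩ => ?_
  rw [sum_totalMap_comp_single hr hn c hc.shape hn1, hc.zero]
  by_cases h : n = 1
  · subst h
    rw [if_pos rfl, leftMul_single, show Finset.Ioo 0 1 = ∅ from rfl, Finset.sum_empty, zero_add]
    have := LinearMap.congr_fun (hc.one l) (Finsupp.single b 1)
    rw [leftMul_single] at this
    rw [← incl_single, this]
    rfl
  · rw [← hc.higher n (by omega), LinearMap.add_apply, LinearMap.neg_apply, add_neg_cancel,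
      map_zero, if_neg h, LinearMap.zero_apply]

/-- The semilinear endomorphisms `c^n ∘ τⁿ` of the total module. -/
noncomputable def semilinearHomotopy (hr : IsRegularElt f) (hn : IsNormalElt f)
    (c : ℕ → ∀ l l', (P.ι l →₀ A) →ₗ[Aᵐᵒᵖ] (P.ι l' →₀ A)) (n : ℕ) :
    ((Σ l, P.ι l) →₀ A) →+ ((Σ l, P.ι l) →₀ A) :=
  (totalMap n (c n)).toAddMonoidHom.comp (mapCoeff (twistHom hr hn n))

theorem semilinearHomotopy_apply (n : ℕ) (x : (Σ l, P.ι l) →₀ A) :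
    semilinearHomotopy hr hn c n x = totalMap n (c n) (mapCoeff (twistHom hr hn n) x) := rfl

/-- The homotopy equations with all twists absorbed into the semilinear maps; this is the input for
`totalDiff_totalDiff` and `exists_totalDiff_eq`. -/
theorem IsHomotopySystem.sum_semilinearHomotopy (hP : P.IsFreeResolution)
    (hc : IsHomotopySystem P hr hn m c) (n : ℕ) (x : (Σ l, P.ι l) →₀ A) :
    ∑ p ∈ Finset.HasAntidiagonal.antidiagonal n,
        semilinearHomotopy hr hn c p.1 (semilinearHomotopy hr hn c p.2 x) =
      if n = 1 then rightMul _ f x else 0 := by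
  have h := congrArg (semilinear hr hn n) (hc.sum_totalMap_comp hP n)
  have h2 : ∀ p ∈ Finset.HasAntidiagonal.antidiagonal n,
      semilinearHomotopy hr hn c p.1 (semilinearHomotopy hr hn c p.2 x) =
      semilinear hr hn n (totalMap p.1 (c p.1) ∘ₗ twist hr hn p.1 (totalMap p.2 (c p.2))) x := by
    intro p hp
    rw [Finset.HasAntidiagonal.mem_antidiagonal] at hp
    rw [← hp, ← semilinear_mul]
    rfl
  rw [Finset.sum_congr rfl h2]
  change ∑ p ∈ Finset.HasAntidiagonal.antidiagonal n,
    (totalMap p.1 (c p.1) ∘ₗ twist hr hn p.1 (totalMap p.2 (c p.2)))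
      (mapCoeff (twistHom hr hn n) x) = _
  rw [← LinearMap.sum_apply, hc.sum_totalMap_comp hP]
  split_ifs with h1
  · subst h1
    exact leftMul_mapCoeff_twistHom hr hn x
  · rfl

theorem IsHomotopySystem.semilinearHomotopy_mem (hc : IsHomotopySystem P hr hn m c) (n : ℕ)
    (L : ℤ) (x : (Σ l, P.ι l) →₀ A) (hx : x ∈ levelPart A Sigma.fst L) :
    semilinearHomotopy hr hn c n x ∈ levelPart A Sigma.fst (L + (2 * n - 1)) :=
  map_mem_levelPart (totalMap_mem_levelPart (hc.shape n)) (mapCoeff_mem_levelPart _ hx)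

theorem IsHomotopySystem.semilinearHomotopy_zero (hc : IsHomotopySystem P hr hn m c)
    (x : (Σ l, P.ι l) →₀ A) : semilinearHomotopy hr hn c 0 x = totalMap 0 P.d x := by
  rw [← hc.zero, semilinearHomotopy_apply]
  congr 1
  ext
  simp

/-- The element of `T_i` with components `τ^s x_s ⊗ 1`. -/
noncomputable def toQuotient (hr : IsRegularElt f) (hn : IsNormalElt f) (i : ℕ)
    (x : ℕ → (Σ l, P.ι l) →₀ A) : (Σ s : Fin (i / 2 + 1), P.ι (i - 2 * s)) →₀ QuotAlg f :=
  ∑ s : Fin (i / 2 + 1), (mapCoeff (quotMap f) (mapCoeff (twistHom hr hn s)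
    (proj A (i - 2 * s) (x s)))).mapDomain (Sigma.mk s)

theorem toQuotient_apply (i : ℕ) (x : ℕ → (Σ l, P.ι l) →₀ A) (s : Fin (i / 2 + 1))
    (b : P.ι (i - 2 * s)) : toQuotient hr hn i x ⟨s, b⟩ =
      quotMap f (twistHom hr hn s (x s ⟨i - 2 * s, b⟩)) :=
  sum_mapDomain_apply (fun s : Fin (i / 2 + 1) => mapCoeff (quotMap f)
    (mapCoeff (twistHom hr hn s) (proj A (i - 2 * s) (x s)))) s b

theorem toQuotient_surjective (i : ℕ)
    (v : (Σ s : Fin (i / 2 + 1), P.ι (i - 2 * s)) →₀ QuotAlg f) :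
    ∃ x : ℕ → (Σ l, P.ι l) →₀ A, (∀ s : ℕ, x s ∈ levelPart A Sigma.fst (i - 2 * s)) ∧
      toQuotient hr hn i x = v := by
  have h : ∀ s : Fin (i / 2 + 1), ∃ w : P.ι (i - 2 * s) →₀ A,
      mapCoeff (quotMap f) (mapCoeff (twistHom hr hn s) w) =
        Finsupp.comapDomain (Sigma.mk s) v sigma_mk_injective.injOn := by
    intro s
    obtain ⟨w, hw⟩ := mapCoeff_surjective (quotMap_surjective f)
      (Finsupp.comapDomain (Sigma.mk s) v sigma_mk_injective.injOn)
    obtain ⟨w', rfl⟩ := mapCoeff_surjective (twistHom_bijective hr hn s).2 w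
    exact ⟨w', hw⟩
  choose w hw using h
  refine ⟨fun s => if h : s < i / 2 + 1 then incl A (i - 2 * s) (w ⟨s, h⟩) else 0,
    fun s => ?_, ?_⟩
  · dsimp only
    split_ifs with h
    · convert incl_mem_levelPart (A := A) (i - 2 * s) (w ⟨s, h⟩) using 2
      omega
    · exact zero_mem _
  · ext ⟨s, b⟩
    rw [toQuotient_apply, dif_pos s.2, incl_apply]
    exact DFunLike.congr_fun (hw s) b

/-- `τ^s` is bijective and fixes `f`, so `τ^s a ∈ A f` forces `a ∈ A f`. Off the prescribed level
the entries are zero, and regularity keeps the quotient sequence in the same levels. -/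
theorem exists_eq_rightMul_of_toQuotient_eq_zero {i : ℕ} {y : ℕ → (Σ l, P.ι l) →₀ A}
    (hy : ∀ s : ℕ, y s ∈ levelPart A Sigma.fst (i - 2 * s)) (h : toQuotient hr hn i y = 0) :
    ∃ z : ℕ → (Σ l, P.ι l) →₀ A, (∀ s : ℕ, z s ∈ levelPart A Sigma.fst (i - 2 * s)) ∧
      ∀ s, y s = rightMul _ f (z s) := by
  have h1 : ∀ s, ∃ z, y s = rightMul _ f z := by
    refine fun s => exists_eq_rightMul hr fun ⟨l, b⟩ => ?_
    by_cases hl : l + 2 * s = i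
    · obtain rfl : l = i - 2 * s := by omega
      have h2 := toQuotient_apply (hr := hr) (hn := hn) i y ⟨s, by omega⟩ b
      rw [h] at h2
      obtain ⟨a, ha⟩ := exists_eq_mul_of_quotMap_eq_zero hn h2.symm
      obtain ⟨a, rfl⟩ := (twistHom_bijective hr hn s).2 a
      refine ⟨a, (twistHom_bijective hr hn s).1 ?_⟩
      rw [map_mul, twistHom_self]
      exact ha
    · exact ⟨0, by rw [hy s ⟨l, b⟩ (by dsimp only; omega), zero_mul]⟩
  choose z hz using h1
  refine ⟨z, fun s j hj => hr _ (Or.inl ?_), hz⟩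
  have h2 := hy s j hj
  rwa [hz] at h2

theorem toQuotient_rightMul (i : ℕ) (y : ℕ → (Σ l, P.ι l) →₀ A) :
    toQuotient hr hn i (fun s => rightMul _ f (y s)) = 0 := by
  ext ⟨s, b⟩
  rw [toQuotient_apply]
  simp [quotMap_self, twistHom_self]

/-- The twist `τ^s` in the s-th coordinate absorbs the twist of row `t`: `(τ^t c)(τ^s x) = τ^t (c
(τ^{s-t} x))`. With `s = t + n` the inner term is `E_n x_{t+n}`. -/
theorem quotientSequence_d_toQuotient {i N : ℕ}
    (hN : i + 2 ≤ N) {x : ℕ → (Σ l, P.ι l) →₀ A}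
    (hx : ∀ s : ℕ, x s ∈ levelPart A Sigma.fst (i + 1 - 2 * s)) :
    (quotientSequence P hr hn m c).d (i + 1) i (toQuotient hr hn (i + 1) x) =
      toQuotient hr hn i (totalDiff (semilinearHomotopy hr hn c) N x) := by
  refine (blockMatrix_sum_mapDomain (A := QuotAlg f)
    (ι := fun s : Fin ((i + 1) / 2 + 1) => P.ι (i + 1 - 2 * s))
    (κ := fun t : Fin (i / 2 + 1) => P.ι (i - 2 * t))
    (fun s t => if (t : ℕ) ≤ s then
      mapEntries (quotMap f) (twist hr hn t (c (s - t) (i + 1 - 2 * s) (i - 2 * t))) else 0)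
    (fun s => mapCoeff (quotMap f) (mapCoeff (twistHom hr hn s)
      (proj A (i + 1 - 2 * s) (x s))))).trans (Finset.sum_congr rfl fun t _ => ?_)
  congr 1
  let G : ℕ → (P.ι (i - 2 * t) →₀ A) := fun s =>
    c (s - t) (i + 1 - 2 * s) (i - 2 * t)
      (mapCoeff (twistHom hr hn (s - t)) (proj A (i + 1 - 2 * s) (x s)))
  have hx0 : ∀ s, i + 1 < 2 * s → x s = 0 := fun s hs =>
    eq_zero_of_mem_levelPart_of_neg (by omega) (hx s)
  have h1 : ∀ s : Fin ((i + 1) / 2 + 1), (if (t : ℕ) ≤ s then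
      mapEntries (quotMap f) (twist hr hn t (c (s - t) (i + 1 - 2 * s) (i - 2 * t))) else 0)
        (mapCoeff (quotMap f) (mapCoeff (twistHom hr hn s) (proj A (i + 1 - 2 * s) (x s)))) =
      (fun s : ℕ => if (t : ℕ) ≤ s then
        mapCoeff (quotMap f) (mapCoeff (twistHom hr hn t) (G s)) else 0) s := by
    intro s
    dsimp only
    split_ifs with h
    · have e : (s : ℕ) = t + (s - t) := by omega
      rw [mapEntries_mapCoeff]
      conv_lhs => rw [e]
      rw [mapCoeff_twistHom_add, twist_mapCoeff, ← e]
    · rfl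
  rw [Finset.sum_congr rfl fun s _ => h1 s,
    Fin.sum_univ_eq_sum_range (fun s : ℕ => if (t : ℕ) ≤ s then
        mapCoeff (quotMap f) (mapCoeff (twistHom hr hn t) (G s)) else 0)]
  have h2 : ∀ n ∈ Finset.range N, proj A (i - 2 * t)
      (semilinearHomotopy hr hn c n (x (t + n))) = G (t + n) := by
    intro n _
    by_cases hs : 2 * (t + n) ≤ i + 1
    · have h3 : incl A (i + 1 - 2 * (t + n)) (proj A _ (x (t + n))) = x (t + n) := by
        refine incl_proj ?_
        convert hx (t + n) using 2
        omega
      dsimp only [G]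
      rw [Nat.add_sub_cancel_left]
      conv_lhs => rw [← h3]
      rw [semilinearHomotopy_apply, mapCoeff_incl,
        totalMap_incl (l' := i - 2 * t) (by omega), proj_incl]
    · simp [G, hx0 (t + n) (by omega)]
  rw [totalDiff, map_sum, Finset.sum_congr rfl h2, map_sum, map_sum]
  have h4 : ∀ s, i + 1 < 2 * s → G s = 0 := by
    intro s hs
    simp [G, hx0 s hs]
  -- The sum over block columns is extended to `s < t + N`; the added terms vanish because `x_s`
  -- then has negative level.
  rw [Finset.sum_subset (Finset.range_mono (by omega : (i + 1) / 2 + 1 ≤ t + N)),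
    Finset.sum_range_add]
  · rw [Finset.sum_eq_zero, zero_add]
    · refine Finset.sum_congr rfl fun n _ => ?_
      rw [if_pos (by omega)]
    · intro s hs
      rw [Finset.mem_range] at hs
      rw [if_neg (by omega)]
  · intro s _ hs
    rw [Finset.mem_range] at hs
    simp [h4 s (by omega)]

/-- A cycle lifts to `x` with `D x` divisible by `f`, and `exists_totalDiff_eq` produces a preimage.
Conversely `D² = ρ S` reduces to zero modulo `f`. -/
theorem IsHomotopySystem.quotientSequence_exact (hP : P.IsFreeResolution)
    (hc : IsHomotopySystem P hr hn m c) (i : ℕ) :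
    Function.Exact ((quotientSequence P hr hn m c).d (i + 2) (i + 1))
      ((quotientSequence P hr hn m c).d (i + 1) i) := by
  have hE := hc.sum_semilinearHomotopy hP
  have hlv := hc.semilinearHomotopy_mem
  have hneg : ∀ L < (0 : ℤ), ∀ x ∈ levelPart A (Sigma.fst : (Σ l, P.ι l) → ℕ) L, x = 0 :=
    fun L hL x hx => eq_zero_of_mem_levelPart_of_neg hL hx
  intro v
  constructor
  · intro hv
    obtain ⟨x, hx, rfl⟩ := toQuotient_surjective (hr := hr) (hn := hn) (i + 1) v
    replace hx : ∀ s : ℕ, x s ∈ levelPart A Sigma.fst (i + 1 - 2 * s) := by exact_mod_cast hx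
    have h1 := quotientSequence_d_toQuotient (hr := hr) (hn := hn) (m := m) (c := c) (N := i + 5)
      (by omega) hx
    rw [hv] at h1
    obtain ⟨y, hy, hxy⟩ := exists_eq_rightMul_of_toQuotient_eq_zero
      (fun s => totalDiff_mem hlv hx s) h1.symm
    obtain ⟨z, hz, hzx⟩ := exists_totalDiff_eq hE (rightMul_injective hr)
      (fun n x => DFunLike.congr_fun (semilinear_comm_rightMul hr hn n (totalMap n (c n))) x)
      hneg hlv
      (fun L hL x hx hdx => by
        rw [hc.semilinearHomotopy_zero] at hdx
        obtain ⟨y, hy, hyx⟩ := hP.exists_mem_levelPart hL hx hdx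
        exact ⟨y, hy, (hc.semilinearHomotopy_zero y).trans hyx⟩) (by omega) hx hy hxy
    refine ⟨toQuotient hr hn (i + 2) z, ?_⟩
    rw [quotientSequence_d_toQuotient (i := i + 1) (N := i + 5) (by omega) (by
      intro s
      convert hz s using 2
      push_cast
      ring)]
    congr 1
    exact funext hzx
  · rintro ⟨w, rfl⟩
    obtain ⟨z, hz, rfl⟩ := toQuotient_surjective (hr := hr) (hn := hn) (i + 2) w
    have hz' : ∀ s : ℕ, z s ∈ levelPart A Sigma.fst (((i + 1 : ℕ) : ℤ) + 1 - 2 * s) := by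
      intro s
      convert hz s using 2
      push_cast
      ring
    rw [quotientSequence_d_toQuotient (i := i + 1) (N := i + 5) (by omega) hz',
      quotientSequence_d_toQuotient (N := i + 5) (by omega) (by
        intro s
        have := totalDiff_mem (N := i + 5) hlv hz' s
        exact_mod_cast this)]
    have h3 : totalDiff (semilinearHomotopy hr hn c) (i + 5)
        (totalDiff (semilinearHomotopy hr hn c) (i + 5) z) =
        fun s => rightMul _ f (z (s + 1)) :=
      funext fun t => totalDiff_totalDiff hE (by omega)
        (fun s hs => hneg _ (by omega) _ (hz' s)) t
    rw [h3]
    exact toQuotient_rightMul i fun s => z (s + 1)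

end QuotientSequence

/-! ### The isomorphism `k_A ≅ k_B` -/

section Residue

variable {k : Type*} [Field k] {A : Type*} [Ring A] [Algebra k A] {𝒜 : ℤ → Submodule k A} {f : A}

theorem residueMap_mkQ (a : A) : residueMap 𝒜 f ((augIdeal 𝒜).mkQ a) =
    (augIdeal (quotGrading 𝒜 f)).mkQ (quotMap f a) := rfl

theorem residueMap_smul (a : A) (x : TrivialModule 𝒜) :
    residueMap 𝒜 f (op a • x) = op (quotMap f a) • residueMap 𝒜 f x := by
  obtain ⟨b, rfl⟩ := (augIdeal 𝒜).mkQ_surjective x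
  rfl

theorem residueMap_surjective : Function.Surjective (residueMap 𝒜 f) := by
  intro x
  obtain ⟨b, rfl⟩ := (augIdeal (quotGrading 𝒜 f)).mkQ_surjective x
  obtain ⟨a, rfl⟩ := quotMap_surjective f b
  exact ⟨(augIdeal 𝒜).mkQ a, rfl⟩

/-- The kernel `A f` of `A → B` lies in `A_{≥1}`, and `B_{≥1}` is the image of `A_{≥1}`; hence
`A_{≥1}` is the full preimage of `B_{≥1}`. -/
theorem residueMap_injective [GradedAlgebra 𝒜] (hA : IsConnectedGraded 𝒜) {m : ℤ} (hm : 1 ≤ m)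
    (hfm : f ∈ 𝒜 m) (hn : IsNormalElt f) : Function.Injective (residueMap 𝒜 f) := by
  have hker : ∀ a, quotMap f a = 0 → a ∈ augIdeal 𝒜 := by
    intro a ha
    obtain ⟨b, rfl⟩ := exists_eq_mul_of_quotMap_eq_zero hn ha
    exact mul_mem_augIdeal hA b (mem_augIdeal_of_mem hm hfm)
  have hsub : ∀ a b, quotMap f a = quotMap f b → b ∈ augIdeal 𝒜 → a ∈ augIdeal 𝒜 := by
    intro a b hab hb
    rw [← sub_add_cancel a b]
    exact add_mem (hker _ (by rw [map_sub, hab, sub_self])) hb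
  have key : ∀ y ∈ augIdeal (quotGrading 𝒜 f), ∃ a ∈ augIdeal 𝒜, quotMap f a = y := by
    intro y hy
    induction hy using Submodule.span_induction with
    | mem y hy =>
      obtain ⟨i, hi, a, ha, rfl⟩ := hy
      exact ⟨a, mem_augIdeal_of_mem hi ha, rfl⟩
    | zero => exact ⟨0, zero_mem _, map_zero _⟩
    | add x y _ _ hx hy =>
      obtain ⟨a, ha, rfl⟩ := hx
      obtain ⟨b, hb, rfl⟩ := hy
      exact ⟨a + b, add_mem ha hb, map_add _ _ _⟩
    | smul r x _ hx =>
      obtain ⟨a, ha, rfl⟩ := hx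
      obtain ⟨s, hs⟩ := quotMap_surjective f r.unop
      refine ⟨a * s, mul_mem_augIdeal_right ha s, ?_⟩
      rw [map_mul, hs]
      rfl
  rw [injective_iff_map_eq_zero]
  intro x hx
  obtain ⟨a, rfl⟩ := (augIdeal 𝒜).mkQ_surjective x
  rw [residueMap_mkQ, Submodule.mkQ_apply, Submodule.Quotient.mk_eq_zero] at hx
  obtain ⟨b, hb, hba⟩ := key _ hx
  rw [Submodule.mkQ_apply, Submodule.Quotient.mk_eq_zero]
  exact hsub a b hba.symm hb

theorem residueMap_mem_trivialGrading {p : ℤ} {x : TrivialModule 𝒜} (hx : x ∈ trivialGrading 𝒜 p) :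
    residueMap 𝒜 f x ∈ trivialGrading (quotGrading 𝒜 f) p := by
  obtain ⟨a, ha, rfl⟩ := hx
  exact ⟨quotMap f a, ⟨a, ha, rfl⟩, rfl⟩

end Residue

theorem ofColumns_mapDomain_mapCoeff {A B : Type*} [Ring A] [Ring B] {M N : Type*}
    [AddCommGroup M] [Module Aᵐᵒᵖ M] [AddCommGroup N] [Module Bᵐᵒᵖ N] (g : A →+* B) (ρ : M →+ N)
    (hρ : ∀ a x, ρ (op a • x) = op (g a) • ρ x) {ι κ : Type*} (φ : (ι →₀ A) →ₗ[Aᵐᵒᵖ] M)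
    (e : ι → κ) (u : κ → N) (hu : ∀ b, u (e b) = ρ (φ (Finsupp.single b 1))) (w : ι →₀ A) :
    ofColumns u ((mapCoeff g w).mapDomain e) = ρ (φ w) := by
  induction w using Finsupp.induction_linear with
  | zero => simp
  | add x y hx hy => simp [Finsupp.mapDomain_add, hx, hy]
  | single b a =>
    rw [mapCoeff_single, Finsupp.mapDomain_single, ofColumns_single, single_eq_smul_one b a,
      map_smul, hρ, hu]

/-! ### `T` is a graded free resolution of `k_B` -/

section Resolution

variable {k : Type*} [Field k] {A : Type*} [Ring A] [Algebra k A] {𝒜 : ℤ → Submodule k A}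
  {P : AugmentedSequence 𝒜} {f : A} {hr : IsRegularElt f} {hn : IsNormalElt f} {m : ℤ}
  {c : ℕ → ∀ l l', (P.ι l →₀ A) →ₗ[Aᵐᵒᵖ] (P.ι l' →₀ A)}

theorem quotientSequence_ε_toQuotient (x : ℕ → (Σ l, P.ι l) →₀ A) :
    (quotientSequence P hr hn m c).ε (toQuotient hr hn 0 x) =
      residueMap 𝒜 f (P.ε (proj A 0 (x 0))) := by
  have h1 : toQuotient hr hn 0 x = (mapCoeff (quotMap f) (proj A 0 (x 0))).mapDomain
      (fun b => (⟨0, b⟩ : Σ s : Fin (0 / 2 + 1), P.ι (0 - 2 * s))) := by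
    ext ⟨s, b⟩
    obtain rfl : s = 0 := Subsingleton.elim (α := Fin 1) _ _
    rw [toQuotient_apply]
    have h2 := Finsupp.mapDomain_apply (sigma_mk_injective (β := fun s : Fin (0 / 2 + 1) =>
      P.ι (0 - 2 * s)) (i := 0)) (mapCoeff (quotMap f) (proj A 0 (x 0))) b
    exact h2.symm
  rw [h1]
  exact ofColumns_mapDomain_mapCoeff _ (residueMap 𝒜 f) residueMap_smul P.ε
    (fun b => (⟨0, b⟩ : Σ s : Fin (0 / 2 + 1), P.ι (0 - 2 * s)))
    (fun x => residueMap 𝒜 f (P.ε (Finsupp.single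
      (cast (congrArg P.ι (Nat.zero_sub (2 * (x.1 : ℕ)))) x.2) 1))) (fun _ => rfl) _

theorem twistHom_quot_mem [GradedAlgebra 𝒜] (hfm : f ∈ 𝒜 m) (n : ℕ) {a : A} {p : ℤ}
    (ha : a ∈ 𝒜 p) : quotMap f (twistHom hr hn n a) ∈ quotGrading 𝒜 f p :=
  ⟨_, twistHom_mem 𝒜 hfm hr hn n ha, rfl⟩

theorem quotientSequence_d_single (i j : ℕ) (s : Fin (i / 2 + 1)) (b : P.ι (i - 2 * s))
    (t : Fin (j / 2 + 1)) (a : P.ι (j - 2 * t)) :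
    (quotientSequence P hr hn m c).d i j (Finsupp.single ⟨s, b⟩ 1) ⟨t, a⟩ =
      if (t : ℕ) ≤ s then quotMap f (twistHom hr hn t
        (c (s - t) (i - 2 * s) (j - 2 * t) (Finsupp.single b 1) a)) else 0 := by
  have h := blockMatrix_mapDomain (A := QuotAlg f)
    (ι := fun s : Fin (i / 2 + 1) => P.ι (i - 2 * s))
    (κ := fun t : Fin (j / 2 + 1) => P.ι (j - 2 * t))
    (fun s t => if (t : ℕ) ≤ s then
      mapEntries (quotMap f) (twist hr hn t (c (s - t) (i - 2 * s) (j - 2 * t))) else 0)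
    s (Finsupp.single b 1)
  rw [Finsupp.mapDomain_single] at h
  refine (DFunLike.congr_fun h ⟨t, a⟩).trans ?_
  refine (sum_mapDomain_apply (A := QuotAlg f) (ι := fun t : Fin (j / 2 + 1) => P.ι (j - 2 * t))
    (fun t => (if (t : ℕ) ≤ s then
      mapEntries (quotMap f) (twist hr hn t (c (s - t) (i - 2 * s) (j - 2 * t))) else 0)
        (Finsupp.single b 1)) t a).trans ?_
  split_ifs
  · rw [mapEntries_single, mapCoeff_apply, twist_single, mapCoeff_apply]
  · rfl

theorem quotientSequence_d_degree [GradedAlgebra 𝒜] (hfm : f ∈ 𝒜 m)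
    (hc : IsHomotopySystem P hr hn m c) (i j : ℕ)
    (x : (quotientSequence P hr hn m c).ι i) (y : (quotientSequence P hr hn m c).ι j) :
    (quotientSequence P hr hn m c).d i j (Finsupp.single x 1) y ∈ quotGrading 𝒜 f
      ((quotientSequence P hr hn m c).deg i x - (quotientSequence P hr hn m c).deg j y) := by
  obtain ⟨s, b⟩ := x
  obtain ⟨t, a⟩ := y
  have h := quotientSequence_d_single (hr := hr) (hn := hn) (m := m) (c := c) i j s b t a
  refine h ▸ ?_
  split_ifs with hts
  · refine twistHom_quot_mem hfm t ?_
    have e : (quotientSequence P hr hn m c).deg i ⟨s, b⟩ -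
        (quotientSequence P hr hn m c).deg j ⟨t, a⟩ =
        P.deg (i - 2 * s) b + ((s - t : ℕ) : ℤ) * m - P.deg (j - 2 * t) a := by
      change P.deg (i - 2 * s) b + (s : ℕ) * m - (P.deg (j - 2 * t) a + (t : ℕ) * m) = _
      rw [Nat.cast_sub hts]
      ring
    rw [e]
    exact hc.degree (s - t) (i - 2 * s) (j - 2 * t) b a
  · exact zero_mem _

theorem IsHomotopySystem.quotientSequence_isFreeResolution [GradedAlgebra 𝒜]
    (hA : IsConnectedGraded 𝒜) (hm : 1 ≤ m) (hfm : f ∈ 𝒜 m) (hP : P.IsFreeResolution)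
    (hc : IsHomotopySystem P hr hn m c) : (quotientSequence P hr hn m c).IsFreeResolution where
  shape i j hij := by
    refine linearMap_ext fun ⟨s, b⟩ => ?_
    ext ⟨t, a⟩
    refine (quotientSequence_d_single i j s b t a).trans ?_
    split_ifs with hts
    · rw [hc.shape _ _ _ (by omega)]
      exact (congrArg (quotMap f) (map_zero _)).trans (map_zero _)
    · rfl
  d_degree := quotientSequence_d_degree hfm hc
  ε_degree := by
    rintro ⟨s, b⟩
    obtain rfl : s = 0 := Subsingleton.elim (α := Fin 1) _ _
    have h : (quotientSequence P hr hn m c).ε (Finsupp.single ⟨0, b⟩ 1) =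
        residueMap 𝒜 f (P.ε (Finsupp.single b 1)) := by
      refine (ofColumns_single _ _ _).trans ?_
      rw [op_one, one_smul]
      rfl
    rw [h]
    have e : (quotientSequence P hr hn m c).deg 0 ⟨0, b⟩ = P.deg 0 b := by
      change P.deg 0 b + ((0 : ℕ) : ℤ) * m = _
      simp
    rw [e]
    exact residueMap_mem_trivialGrading (hP.ε_degree b)
  exact := hc.quotientSequence_exact hP
  -- `T_0` and `T_1` have only the summand `s = 0`, so `D` reduces to `d`. As `k_A → k_B` is
  -- injective, a lift of a cycle is already a cycle over `A`, and exactness of `P` at `P_0`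
  -- suffices.
  exact_zero := by
    intro v
    constructor
    · intro hv
      obtain ⟨x, hx, rfl⟩ := toQuotient_surjective (hr := hr) (hn := hn) 0 v
      rw [quotientSequence_ε_toQuotient] at hv
      obtain ⟨z, hz⟩ := (hP.exact_zero _).mp
        ((injective_iff_map_eq_zero _).mp (residueMap_injective hA hm hfm hn) _ hv)
      have hz' : ∀ s : ℕ, (if s = 0 then incl A 1 z else 0) ∈
          levelPart A Sigma.fst (((0 : ℕ) : ℤ) + 1 - 2 * s) := by
        intro s
        split_ifs with hs
        · subst hs
          exact_mod_cast incl_mem_levelPart 1 z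
        · exact zero_mem _
      refine ⟨toQuotient hr hn 1 (fun s => if s = 0 then incl A 1 z else 0), ?_⟩
      rw [quotientSequence_d_toQuotient (i := 0) (N := 2) (by omega) hz']
      congr 1
      funext t
      rw [totalDiff_of_pos_eq_zero (by omega) (fun s hs => if_neg (by omega)),
        hc.semilinearHomotopy_zero]
      split_ifs with ht
      · subst ht
        rw [totalMap_incl (l' := 0) (by omega), hz]
        exact incl_proj (by simpa using hx 0)
      · rw [map_zero, eq_zero_of_mem_levelPart_of_neg (by omega) (hx t)]
    · rintro ⟨w, rfl⟩
      obtain ⟨z, hz, rfl⟩ := toQuotient_surjective (hr := hr) (hn := hn) 1 w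
      have hz' : ∀ s : ℕ, z s ∈ levelPart A Sigma.fst (((0 : ℕ) : ℤ) + 1 - 2 * s) := by
        intro s
        exact_mod_cast hz s
      rw [quotientSequence_d_toQuotient (i := 0) (N := 2) (by omega) hz',
        quotientSequence_ε_toQuotient, totalDiff_of_pos_eq_zero (by omega)
          (fun s hs => eq_zero_of_mem_levelPart_of_neg (by omega) (hz s)),
        hc.semilinearHomotopy_zero, ← incl_proj (l := 1) (x := z 0) (by simpa using hz 0),
        totalMap_incl (l' := 0) (by omega), proj_incl, hP.exact_zero.apply_apply_eq_zero, map_zero]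
  surjective := by
    intro v
    obtain ⟨x, rfl⟩ := residueMap_surjective v
    obtain ⟨w, rfl⟩ := hP.surjective x
    refine ⟨toQuotient hr hn 0 (fun _ => incl A 0 w), ?_⟩
    rw [quotientSequence_ε_toQuotient, proj_incl]

end Resolution

/-! ### Components in internally graded modules -/

section Components

variable {M N : Type*} [AddCommGroup M] [AddCommGroup N] {G : ℤ → AddSubgroup M}
  {H : ℤ → AddSubgroup N}

theorem exists_components (hG : DirectSum.IsInternal G) :
    ∃ π : ℤ → M →+ M, (∀ p x, π p x ∈ G p) ∧ (∀ p, ∀ x ∈ G p, π p x = x) ∧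
      ∀ p q, ∀ x ∈ G p, p ≠ q → π q x = 0 := by
  let _ := hG.chooseDecomposition
  refine ⟨fun p => (G p).subtype.comp ((DFinsupp.evalAddMonoidHom p).comp
    (DirectSum.decomposeAddEquiv G).toAddMonoidHom), fun p x => SetLike.coe_mem _,
    fun p x hx => DirectSum.decompose_of_mem_same G hx,
    fun p q x hx hpq => DirectSum.decompose_of_mem_ne G hx hpq⟩

theorem isInternal_induction (hG : DirectSum.IsInternal G) {r : M → Prop} (h0 : r 0)
    (hadd : ∀ x y, r x → r y → r (x + y)) (h : ∀ p, ∀ x ∈ G p, r x) (x : M) : r x := by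
  classical
  let _ := hG.chooseDecomposition
  rw [← DirectSum.sum_support_decompose G x]
  exact Finset.sum_induction _ r hadd h0 fun p _ => h p _ (SetLike.coe_mem _)

/-- A graded map commutes with the projections to components, so `x` may be replaced by its degree
`p` component. -/
theorem exists_mem_of_apply_mem (hG : DirectSum.IsInternal G) (hH : DirectSum.IsInternal H)
    {d : M →+ N} (hd : ∀ p, ∀ x ∈ G p, d x ∈ H p) {p : ℤ} {x : M} (hx : d x ∈ H p) :
    ∃ y ∈ G p, d y = d x := by
  obtain ⟨π, h1, h2, h3⟩ := exists_components hG
  obtain ⟨π', -, h2', h3'⟩ := exists_components hH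
  have key : ∀ x, d (π p x) = π' p (d x) := by
    refine isInternal_induction hG (by simp) (fun x y hx hy => by simp [hx, hy]) fun q x hxq => ?_
    by_cases hq : q = p
    · subst hq
      rw [h2 q x hxq, h2' q _ (hd q x hxq)]
    · rw [h3 q p x hxq hq, h3' q p _ (hd q x hxq) hq, map_zero]
  exact ⟨π p x, h1 p x, by rw [key, h2' p _ hx]⟩

end Components

/-! ### Lifting through projective and free modules -/

section Lifting

variable {R : Type*} [Ring R] {L M N : Type*} [AddCommGroup L] [Module R L] [AddCommGroup M]
  [Module R M] [AddCommGroup N] [Module R N]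

theorem exists_comp_eq_of_projective [Module.Projective R L] (φ : M →ₗ[R] N) (g : L →ₗ[R] N)
    (hg : ∀ x, g x ∈ LinearMap.range φ) : ∃ h : L →ₗ[R] M, φ ∘ₗ h = g := by
  obtain ⟨h, hh⟩ := Module.projective_lifting_property φ.rangeRestrict
    (g.codRestrict (LinearMap.range φ) hg) φ.surjective_rangeRestrict
  refine ⟨h, LinearMap.ext fun x => ?_⟩
  exact congrArg Subtype.val (LinearMap.congr_fun hh x)

theorem exists_linearMap_single {A : Type*} [Ring A] {ι M : Type*} [AddCommGroup M] [Module Aᵐᵒᵖ M]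
    {r : ι → M → Prop} (h : ∀ b, ∃ y, r b y) :
    ∃ φ : (ι →₀ A) →ₗ[Aᵐᵒᵖ] M, ∀ b, r b (φ (Finsupp.single b 1)) := by
  choose y hy using h
  refine ⟨ofColumns y, fun b => ?_⟩
  rw [ofColumns_single, op_one, one_smul]
  exact hy b

theorem exists_comp_eq {A : Type*} [Ring A] {ι M N : Type*} [AddCommGroup M] [Module Aᵐᵒᵖ M]
    [AddCommGroup N] [Module Aᵐᵒᵖ N] (φ : M →ₗ[Aᵐᵒᵖ] N) (g : (ι →₀ A) →ₗ[Aᵐᵒᵖ] N)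
    (hg : ∀ x, g x ∈ LinearMap.range φ) : ∃ h : (ι →₀ A) →ₗ[Aᵐᵒᵖ] M, φ ∘ₗ h = g := by
  obtain ⟨h, hh⟩ := exists_linearMap_single (A := A) (r := fun b y => φ y = g (Finsupp.single b 1))
    fun b => hg (Finsupp.single b 1)
  exact ⟨h, linearMap_ext hh⟩

end Lifting

/-! ### Off-diagonal degrees of a linear resolution -/

namespace LinearResolution

variable {k : Type*} [Field k] {A : Type*} [Ring A] [Algebra k A] {𝒜 : ℤ → Submodule k A}

instance (Q : LinearResolution 𝒜) (i : ℕ) : AddCommGroup (Q.Q i) := Q.addCommGroup i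

instance (Q : LinearResolution 𝒜) (i : ℕ) : Module Aᵐᵒᵖ (Q.Q i) := Q.module i

instance (Q : LinearResolution 𝒜) (i : ℕ) : Module.Projective Aᵐᵒᵖ (Q.Q i) := Q.projective i

variable [GradedAlgebra 𝒜]

/-- Elements of `Q_i` of degree different from `i` lie in `Q_i A_{≥ 1}`. -/
theorem apply_mem_augIdeal (hA : IsConnectedGraded 𝒜) (Q : LinearResolution 𝒜) {i : ℕ} {ι : Type*}
    (ψ : Q.Q i →ₗ[Aᵐᵒᵖ] (ι →₀ A)) {p : ℤ} (hp : p ≠ i) {x : Q.Q i} (hx : x ∈ Q.grading i p)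
    (b : ι) : ψ x b ∈ augIdeal 𝒜 := by
  classical
  obtain ⟨π, -, h2, h3⟩ := exists_components (Q.isInternal i)
  -- The scalar `r` is built in so that the induction over the span of degree `i` passes through
  -- scalar multiples. For a generator, the degree `p` component of `x r` is `x` times the component
  -- of `r` in degree `p - i ≠ 0`, which is zero or lies in `A_{≥1}`.
  have key : ∀ x : Q.Q i, ∀ r : A, ψ (π p (op r • x)) b ∈ augIdeal 𝒜 := by
    intro x
    have hx : x ∈ Submodule.span Aᵐᵒᵖ (Q.grading i i : Set (Q.Q i)) := by
      rw [Q.generated i]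
      trivial
    induction hx using Submodule.span_induction with
    | mem x hx =>
      intro r
      rw [← DirectSum.sum_support_decompose 𝒜 r, Finset.op_sum, Finset.sum_smul, map_sum, map_sum,
        Finsupp.finsetSum_apply]
      refine sum_mem fun q _ => ?_
      have hq := Q.smul_mem i i q x hx _ (SetLike.coe_mem (DirectSum.decompose 𝒜 r q))
      by_cases hpq : (i : ℤ) + q = p
      · rw [hpq] at hq
        rw [h2 p _ hq, map_smul]
        rcases lt_or_ge q 1 with hq1 | hq1
        · rw [hA.eq_zero_of_neg (i := q) (by omega) (SetLike.coe_mem _)]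
          simp
        · exact mul_mem_augIdeal hA _ (mem_augIdeal_of_mem hq1 (SetLike.coe_mem _))
      · rw [h3 _ p _ hq hpq, map_zero]
        exact zero_mem _
    | zero =>
      intro r
      simp
    | add x y _ _ hx hy =>
      intro r
      rw [smul_add, map_add, map_add]
      exact add_mem (hx r) (hy r)
    | smul s x _ hx =>
      intro r
      rw [← mul_smul]
      exact hx (s.unop * r)
  have h := key x 1
  rwa [op_one, one_smul, h2 p x hx] at h

end LinearResolution

/-! ### Comparison of a minimal resolution with a linear one -/

section Comparison

variable {k : Type*} [Field k] {A : Type*} [Ring A] [Algebra k A] {𝒜 : ℤ → Submodule k A}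
  {P : AugmentedSequence 𝒜}

theorem LinearResolution.apply_mem_grading (Q : LinearResolution 𝒜) {i : ℕ} {ι : Type*}
    {deg : ι → ℤ} {φ : (ι →₀ A) →ₗ[Aᵐᵒᵖ] Q.Q i}
    (hφ : ∀ b, φ (Finsupp.single b 1) ∈ Q.grading i (deg b)) {p : ℤ} {x : ι →₀ A}
    (hx : ∀ b, x b ∈ 𝒜 (p - deg b)) : φ x ∈ Q.grading i p := by
  rw [← Finsupp.sum_single x, Finsupp.sum, map_sum]
  refine sum_mem fun b _ => ?_
  rw [single_eq_smul_one, map_smul]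
  convert Q.smul_mem i _ _ _ (hφ b) _ (hx b) using 2
  omega

/-- `k_A` is concentrated in degree 0, so `ε` kills all other components of a preimage. -/
theorem LinearResolution.exists_mem_grading_ε [GradedAlgebra 𝒜] (hA : IsConnectedGraded 𝒜)
    (Q : LinearResolution 𝒜) {p : ℤ} {x : TrivialModule 𝒜} (hx : x ∈ trivialGrading 𝒜 p) :
    ∃ y ∈ Q.grading 0 p, Q.ε y = x := by
  by_cases hp : p = 0
  · subst hp
    obtain ⟨π, h1, h2, h3⟩ := exists_components (Q.isInternal 0)
    obtain ⟨y, rfl⟩ := Q.surjective x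
    refine ⟨π 0 y, h1 0 y, ?_⟩
    refine isInternal_induction (Q.isInternal 0) (r := fun y => Q.ε (π 0 y) = Q.ε y) (by simp)
      (fun x y hx hy => by simp [hx, hy]) (fun q y hy => ?_) y
    by_cases hq : q = 0
    · subst hq
      rw [h2 0 y hy]
    · rw [h3 q 0 y hy hq, map_zero, eq_zero_of_mem_trivialGrading hA hq (Q.ε_degree q y hy)]
  · exact ⟨0, zero_mem _, by rw [map_zero, eq_zero_of_mem_trivialGrading hA hp hx]⟩

theorem LinearResolution.exists_mem_grading_d (Q : LinearResolution 𝒜) {i : ℕ} {p : ℤ} {x : Q.Q i}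
    (hx : x ∈ Q.grading i p) (hd : x ∈ LinearMap.range (Q.d i)) :
    ∃ y ∈ Q.grading (i + 1) p, Q.d i y = x := by
  obtain ⟨y, rfl⟩ := hd
  exact exists_mem_of_apply_mem (Q.isInternal (i + 1)) (Q.isInternal i)
    (d := (Q.d i).toAddMonoidHom) (Q.d_degree i) hx

theorem exists_graded_chainMap [GradedAlgebra 𝒜] (hA : IsConnectedGraded 𝒜)
    (hP : P.IsFreeResolution) (Q : LinearResolution 𝒜) :
    ∃ φ : ∀ n, (P.ι n →₀ A) →ₗ[Aᵐᵒᵖ] Q.Q n,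
      (∀ n b, φ n (Finsupp.single b 1) ∈ Q.grading n (P.deg n b)) ∧ Q.ε ∘ₗ φ 0 = P.ε ∧
        ∀ n, Q.d n ∘ₗ φ (n + 1) = φ n ∘ₗ P.d (n + 1) n := by
  obtain ⟨φ₀, hφ₀⟩ := exists_linearMap_single (A := A)
    (r := fun b y => y ∈ Q.grading 0 (P.deg 0 b) ∧ Q.ε y = P.ε (Finsupp.single b 1))
    fun b => Q.exists_mem_grading_ε hA (hP.ε_degree b)
  have hε : Q.ε ∘ₗ φ₀ = P.ε := linearMap_ext fun b => (hφ₀ b).2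
  obtain ⟨φ, h0, h1, h2⟩ := exists_dependent_sequence
    (X := fun n => (P.ι n →₀ A) →ₗ[Aᵐᵒᵖ] Q.Q n)
    (fun n φ => (∀ b, φ (Finsupp.single b 1) ∈ Q.grading n (P.deg n b)) ∧
      ∀ x, φ (P.d (n + 1) n x) ∈ LinearMap.range (Q.d n))
    (fun n φ φ' => Q.d n ∘ₗ φ' = φ ∘ₗ P.d (n + 1) n) φ₀
    ⟨fun b => (hφ₀ b).1, fun x => (Q.exact_zero _).mp (by
      rw [← LinearMap.comp_apply, hε, hP.exact_zero.apply_apply_eq_zero])⟩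
    (by
      rintro n φ ⟨hg, hφ⟩
      obtain ⟨φ', hφ'⟩ := exists_linearMap_single (A := A)
        (r := fun b y => y ∈ Q.grading (n + 1) (P.deg (n + 1) b) ∧
          Q.d n y = φ (P.d (n + 1) n (Finsupp.single b 1)))
        fun b => Q.exists_mem_grading_d (Q.apply_mem_grading hg (hP.d_degree (n + 1) n b)) (hφ _)
      have hc : Q.d n ∘ₗ φ' = φ ∘ₗ P.d (n + 1) n := linearMap_ext fun b => (hφ' b).2
      refine ⟨φ', ⟨fun b => (hφ' b).1, fun x => (Q.exact n _).mp ?_⟩, hc⟩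
      rw [← LinearMap.comp_apply, hc, LinearMap.comp_apply, (hP.exact n).apply_apply_eq_zero,
        map_zero])
  exact ⟨φ, fun n => (h1 n).1, by rw [h0, hε], h2⟩

/-- No degrees are tracked in this direction: `LinearResolution.apply_mem_augIdeal` holds for every
right linear map out of `Q_i`. -/
theorem exists_chainMap (hP : P.IsFreeResolution) (Q : LinearResolution 𝒜) :
    ∃ ψ : ∀ n, Q.Q n →ₗ[Aᵐᵒᵖ] (P.ι n →₀ A), P.ε ∘ₗ ψ 0 = Q.ε ∧
      ∀ n, P.d (n + 1) n ∘ₗ ψ (n + 1) = ψ n ∘ₗ Q.d n := by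
  obtain ⟨ψ₀, hψ₀⟩ := exists_comp_eq_of_projective P.ε Q.ε fun x => hP.surjective _
  obtain ⟨ψ, h0, h1, h2⟩ := exists_dependent_sequence
    (X := fun n => Q.Q n →ₗ[Aᵐᵒᵖ] (P.ι n →₀ A))
    (fun n ψ => ∀ x, ψ (Q.d n x) ∈ LinearMap.range (P.d (n + 1) n))
    (fun n ψ ψ' => P.d (n + 1) n ∘ₗ ψ' = ψ ∘ₗ Q.d n) ψ₀
    (fun x => (hP.exact_zero _).mp (by
      rw [← LinearMap.comp_apply, hψ₀, Q.exact_zero.apply_apply_eq_zero]))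
    (by
      intro n ψ hψ
      obtain ⟨ψ', hψ'⟩ := exists_comp_eq_of_projective (P.d (n + 1) n) (ψ ∘ₗ Q.d n) hψ
      refine ⟨ψ', fun x => (hP.exact n _).mp ?_, hψ'⟩
      rw [← LinearMap.comp_apply, hψ', LinearMap.comp_apply, (Q.exact n).apply_apply_eq_zero,
        map_zero])
  exact ⟨ψ, by rw [h0, hψ₀], h2⟩

/-- A chain endomorphism of a free resolution that lifts zero is null-homotopic. -/
theorem AugmentedSequence.IsFreeResolution.exists_homotopy (hP : P.IsFreeResolution)
    (g : ∀ n, (P.ι n →₀ A) →ₗ[Aᵐᵒᵖ] (P.ι n →₀ A)) (hε : ∀ x, P.ε (g 0 x) = 0)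
    (hg : ∀ n x, P.d (n + 1) n (g (n + 1) x) = g n (P.d (n + 1) n x)) :
    ∃ h : ∀ n, (P.ι n →₀ A) →ₗ[Aᵐᵒᵖ] (P.ι (n + 1) →₀ A),
      (∀ x, P.d 1 0 (h 0 x) = g 0 x) ∧
      ∀ n x, P.d (n + 2) (n + 1) (h (n + 1) x) = g (n + 1) x - h n (P.d (n + 1) n x) := by
  obtain ⟨h₀, hh₀⟩ := exists_comp_eq (P.d 1 0) (g 0) fun x => (hP.exact_zero _).mp (hε x)
  have hh₀' : ∀ x, P.d 1 0 (h₀ x) = g 0 x := LinearMap.congr_fun hh₀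
  obtain ⟨h, h0, -, h2⟩ := exists_dependent_sequence
    (X := fun n => (P.ι n →₀ A) →ₗ[Aᵐᵒᵖ] (P.ι (n + 1) →₀ A))
    (fun n h => ∀ x, g (n + 1) x - h (P.d (n + 1) n x) ∈ LinearMap.range (P.d (n + 2) (n + 1)))
    (fun n h h' => ∀ x, P.d (n + 2) (n + 1) (h' x) = g (n + 1) x - h (P.d (n + 1) n x)) h₀
    (fun x => (hP.exact 0 _).mp (by rw [map_sub, hg, hh₀', sub_self]))
    (by
      intro n h hh
      obtain ⟨h', hh'⟩ := exists_comp_eq (P.d (n + 2) (n + 1)) (g (n + 1) + -(h ∘ₗ P.d (n + 1) n))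
        fun x => by
          rw [LinearMap.add_apply, LinearMap.neg_apply, ← sub_eq_add_neg]
          exact hh x
      have hh'' : ∀ x, P.d (n + 2) (n + 1) (h' x) = g (n + 1) x - h (P.d (n + 1) n x) := by
        intro x
        rw [← LinearMap.comp_apply, hh', LinearMap.add_apply, LinearMap.neg_apply, sub_eq_add_neg]
        rfl
      refine ⟨h', fun x => (hP.exact (n + 1) _).mp ?_, hh''⟩
      rw [map_sub, hg, hh'', (hP.exact n).apply_apply_eq_zero, map_zero, sub_zero, sub_self])
  exact ⟨h, fun x => by rw [h0, hh₀'], h2⟩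

theorem apply_mem_augIdeal_of_forall_mem [GradedAlgebra 𝒜] (hA : IsConnectedGraded 𝒜)
    {ι κ : Type*} (φ : (ι →₀ A) →ₗ[Aᵐᵒᵖ] (κ →₀ A)) {x : ι →₀ A} (hx : ∀ b, x b ∈ augIdeal 𝒜)
    (a : κ) : φ x a ∈ augIdeal 𝒜 := by
  rw [apply_eq_sum]
  exact sum_mem fun b _ => mul_mem_augIdeal hA _ (hx b)

/-- A minimal free resolution of `k_A` over a Koszul algebra is linear. -/
theorem AugmentedSequence.IsFreeResolution.isLinear [GradedAlgebra 𝒜]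
    (hA : IsConnectedGraded 𝒜) (hP : P.IsFreeResolution) (hmin : P.IsMinimal)
    (hK : IsKoszul 𝒜) : P.IsLinear := by
  obtain ⟨Q⟩ := hK
  obtain ⟨φ, hφg, hφε, hφ⟩ := exists_graded_chainMap hA hP Q
  obtain ⟨ψ, hψε, hψ⟩ := exists_chainMap hP Q
  have hφ' : ∀ n x, Q.d n (φ (n + 1) x) = φ n (P.d (n + 1) n x) :=
    fun n => LinearMap.congr_fun (hφ n)
  have hψ' : ∀ n x, P.d (n + 1) n (ψ (n + 1) x) = ψ n (Q.d n x) :=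
    fun n => LinearMap.congr_fun (hψ n)
  let g : ∀ n, (P.ι n →₀ A) →ₗ[Aᵐᵒᵖ] (P.ι n →₀ A) := fun n => ψ n ∘ₗ φ n + -LinearMap.id
  have hg_apply : ∀ n x, g n x = ψ n (φ n x) - x := fun n x => (sub_eq_add_neg _ _).symm
  obtain ⟨h, h0, h1⟩ := hP.exists_homotopy g
    (fun x => by
      rw [hg_apply, map_sub, ← LinearMap.comp_apply, hψε, ← LinearMap.comp_apply, hφε, sub_self])
    (fun n x => by rw [hg_apply, hg_apply, map_sub, hψ', hφ'])
  -- `ψφ - id = d h + h d`, and both terms have entries in `A_{≥1}` by minimality.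
  have hmem : ∀ n x a, g n x a ∈ augIdeal 𝒜 := by
    rintro (_ | n) x a
    · rw [← h0]
      exact hmin 0 _ a
    · rw [← sub_add_cancel (g (n + 1) x) (h n (P.d (n + 1) n x)), ← h1, Finsupp.add_apply]
      exact add_mem (hmin (n + 1) _ a) (apply_mem_augIdeal_of_forall_mem hA _ (hmin n x) a)
  intro n b
  by_contra hb
  -- If `e_b` had degree other than `n`, the b-th coordinate of `ψφ e_b` would lie in `A_{≥1}`; it
  -- is congruent to `1` there, a contradiction.
  have h2 := Q.apply_mem_augIdeal hA (ψ n) hb (hφg n b) b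
  have h3 := sub_mem h2 (hmem n (Finsupp.single b 1) b)
  rw [hg_apply, Finsupp.sub_apply, sub_sub_cancel, Finsupp.single_eq_same] at h3
  exact one_notMem_augIdeal hA h3

end Comparison

/-! ### Degrees of the generators of `T`; minimality and linearity -/

section Degrees

variable {k : Type*} [Field k] {A : Type*} [Ring A] [Algebra k A] {𝒜 : ℤ → Submodule k A}
  {P : AugmentedSequence 𝒜} {f : A} {hr : IsRegularElt f} {hn : IsNormalElt f} {m : ℤ}
  {c : ℕ → ∀ l l', (P.ι l →₀ A) →ₗ[Aᵐᵒᵖ] (P.ι l' →₀ A)}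

theorem AugmentedSequence.IsLinear.quotientSequence_deg (hL : P.IsLinear) (i : ℕ)
    (s : Fin (i / 2 + 1)) (b : P.ι (i - 2 * s)) :
    (quotientSequence P hr hn m c).deg i ⟨s, b⟩ = i + (s : ℕ) * (m - 2) := by
  refine (congrArg (· + ((s : ℕ) : ℤ) * m) (hL (i - 2 * s) b)).trans ?_
  rw [Nat.cast_sub (by omega)]
  push_cast
  ring

theorem AugmentedSequence.IsLinear.quotientSequence_isLinear (hL : P.IsLinear) (hm : m = 2) :
    (quotientSequence P hr hn m c).IsLinear := by
  rintro i ⟨s, b⟩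
  refine (hL.quotientSequence_deg i s b).trans ?_
  rw [hm]
  ring

/-- Entries of the block from `s` to `t ≤ s` have degree `1 + (s - t)(m - 2)`, which is at least 1
when `m ≥ 2`; the other blocks vanish. -/
theorem IsHomotopySystem.quotientSequence_isMinimal [GradedAlgebra 𝒜] (hfm : f ∈ 𝒜 m)
    (hc : IsHomotopySystem P hr hn m c) (hL : P.IsLinear) (hm : 2 ≤ m) :
    (quotientSequence P hr hn m c).IsMinimal := by
  have key : ∀ i x y, (quotientSequence P hr hn m c).d (i + 1) i (Finsupp.single x 1) y ∈
      augIdeal (quotGrading 𝒜 f) := by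
    rintro i ⟨s, b⟩ ⟨t, a⟩
    by_cases hts : (t : ℕ) ≤ s
    · refine Submodule.subset_span ⟨_, ?_, quotientSequence_d_degree hfm hc (i + 1) i ⟨s, b⟩ ⟨t, a⟩⟩
      have h1 := hL.quotientSequence_deg (hr := hr) (hn := hn) (m := m) (c := c) (i + 1) s b
      have h2 := hL.quotientSequence_deg (hr := hr) (hn := hn) (m := m) (c := c) i t a
      refine le_of_le_of_eq ?_ (congrArg₂ (· - ·) h1 h2).symm
      have h3 : ((t : ℕ) : ℤ) * (m - 2) ≤ (s : ℕ) * (m - 2) :=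
        mul_le_mul_of_nonneg_right (by exact_mod_cast hts) (by omega)
      push_cast
      linarith
    · have h := quotientSequence_d_single (hr := hr) (hn := hn) (m := m) (c := c) (i + 1) i s b t a
      rw [if_neg hts] at h
      exact h ▸ zero_mem _
  intro i x y
  refine (apply_eq_sum (A := QuotAlg f) _ x y) ▸ ?_
  exact sum_mem fun z _ => mul_mem_augIdeal_right (key i z y) _

end Degrees

end NormalQuotient

theorem theorem4p6 {k : Type*} [Field k] {A : Type*} [Ring A] [Algebra k A]
    (𝒜 : ℤ → Submodule k A) [GradedAlgebra 𝒜] (hA : IsConnectedGraded 𝒜)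
    (m : ℤ) (hm : 1 ≤ m) (f : A) (hfm : f ∈ 𝒜 m)
    (hr : IsRegularElt f) (hn : IsNormalElt f)
    (P : AugmentedSequence 𝒜) (hP : P.IsFreeResolution) (hPmin : P.IsMinimal) :
    (∃ c, IsHomotopySystem P hr hn m c) ∧
    ∀ c, IsHomotopySystem P hr hn m c →
      (quotientSequence P hr hn m c).IsFreeResolution ∧
      (IsKoszul 𝒜 → 2 ≤ m → (quotientSequence P hr hn m c).IsMinimal) ∧
      (IsKoszul 𝒜 → m = 2 → (quotientSequence P hr hn m c).IsLinear) :=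
  ⟨hP.exists_isHomotopySystem hA hm hfm hr hn, fun _ hc =>
    ⟨hc.quotientSequence_isFreeResolution hA hm hfm hP,
      fun hK h2 => hc.quotientSequence_isMinimal hfm (hP.isLinear hA hPmin hK) h2,
      fun hK h2 => (hP.isLinear hA hPmin hK).quotientSequence_isLinear h2⟩⟩
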